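/- Let $k$ be an arbitrary field, let $n \geq 2$, and let $X \subset \mathbb{P}^{n+1}_k$ be a smooth cubic hypersurface (the closed subscheme defined by a nonzero homogeneous polynomial of degree $3$, assumed smooth over $k$) which contains a $k$-line $L$, i.e. a closed subscheme $L \subset \mathbb{P}^{n+1}_k$ defined by $n$ linearly independent linear forms over $k$. Then $X$ has a unirational parameterization of degree $2$: $X$ is integral and there is a dominant rational map $\mathbb{P}^n_k \dashrightarrow X$ over $k$ whose induced extension of function fields $k(X) \hookrightarrow k(\mathbb{P}^n_k)$ has degree $[k(\mathbb{P}^n_k) : k(X)] = 2$. -/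

import Mathlib

open CategoryTheory AlgebraicGeometry MvPolynomial

universe u

noncomputable section

namespace CubicUnirational

attribute [local instance] MvPolynomial.gradedAlgebra

/-! ### Projective space and its closed subschemes -/

section ProjectiveSpace

variable (k : Type u) [Field k] (n : ℕ)

/-- Projective `n`-space over `k`: `Proj k[x₀, …, xₙ]` for the grading by total degree. -/
def ProjSpace : Scheme.{u} :=
  Proj (homogeneousSubmodule (Fin (n + 1)) k)

/-- The structure morphism from projective `n`-space to `Spec k`. -/
def ProjSpace.toBase : ProjSpace k n ⟶ Spec (CommRingCat.of k) :=
  Proj.toSpecZero (homogeneousSubmodule (Fin (n + 1)) k) ≫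
    Spec.map (CommRingCat.ofHom (algebraMap k (homogeneousSubmodule (Fin (n + 1)) k 0)))

instance ProjSpace.irreducibleSpace : IrreducibleSpace (ProjSpace k n) := by
  let x : ProjectiveSpectrum (homogeneousSubmodule (Fin (n + 1)) k) :=
    { asHomogeneousIdeal := ⊥
      isPrime := by
        rw [HomogeneousIdeal.toIdeal_bot]
        exact Ideal.isPrime_bot
      not_irrelevant_le := by
        intro h
        have h1 : (X 0 : MvPolynomial (Fin (n + 1)) k) ∈
            HomogeneousIdeal.irrelevant (homogeneousSubmodule (Fin (n + 1)) k) := by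
          rw [HomogeneousIdeal.mem_irrelevant_iff, GradedRing.proj_apply,
            DirectSum.decompose_of_mem_ne (i := 1) _ (isHomogeneous_X k 0) one_ne_zero]
        have h2 := h h1
        rw [← HomogeneousIdeal.mem_iff, HomogeneousIdeal.toIdeal_bot] at h2
        exact X_ne_zero (R := k) (0 : Fin (n + 1)) h2 }
  have hx : closure ({x} : Set (ProjectiveSpectrum (homogeneousSubmodule (Fin (n + 1)) k))) =
      Set.univ := by
    refine Set.eq_univ_of_forall fun y ↦ ?_
    rw [← ProjectiveSpectrum.le_iff_mem_closure, ← ProjectiveSpectrum.as_ideal_le_as_ideal]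
    exact bot_le
  have : IsIrreducible
      (Set.univ : Set (ProjectiveSpectrum (homogeneousSubmodule (Fin (n + 1)) k))) := by
    rw [← hx]
    exact isIrreducible_singleton.closure
  have h := irreducibleSpace_def _ |>.mpr this
  exact h

variable {k n}

/-- The basic open set `D₊(xₜ)` of projective space. -/
def ProjSpace.chart (t : Fin (n + 1)) : (ProjSpace k n).Opens :=
  Proj.basicOpen (homogeneousSubmodule (Fin (n + 1)) k) (X t)

/-- The canonical map from the degree-zero part `k[x₀, …, xₙ]_(xₜ)` of the localization at `xₜ`
to the functions on `D₊(xₜ)`. -/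
def ProjSpace.chartSections (t : Fin (n + 1)) :
    CommRingCat.of (HomogeneousLocalization.Away (homogeneousSubmodule (Fin (n + 1)) k) (X t)) ⟶
      Γ(ProjSpace k n, ProjSpace.chart t) :=
  Proj.awayToSection (homogeneousSubmodule (Fin (n + 1)) k) (X t)

/-- For an ideal `I` of `k[x₀, …, xₙ]`, the ideal `I_(xₜ)` of the degree-zero part of the
localization at `xₜ`: the degree-zero elements of the extension of `I` to `k[x₀, …, xₙ][1 / xₜ]`. -/
def idealAway (I : Ideal (MvPolynomial (Fin (n + 1)) k)) (t : Fin (n + 1)) :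
    Ideal (HomogeneousLocalization.Away (homogeneousSubmodule (Fin (n + 1)) k) (X t)) :=
  (I.map (algebraMap (MvPolynomial (Fin (n + 1)) k)
    (Localization.Away (X t : MvPolynomial (Fin (n + 1)) k)))).comap
    (algebraMap (HomogeneousLocalization.Away (homogeneousSubmodule (Fin (n + 1)) k) (X t))
      (Localization.Away (X t : MvPolynomial (Fin (n + 1)) k)))

/-- `i : Z ⟶ ℙⁿ` is (the inclusion of) the closed subscheme of `ℙⁿ` defined by the homogeneous
ideal `I`: it is a closed immersion whose ideal sheaf is `I_(xₜ)` on each chart `D₊(xₜ)`. -/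
structure IsZeroScheme {Z : Scheme.{u}} (i : Z ⟶ ProjSpace k n)
    (I : Ideal (MvPolynomial (Fin (n + 1)) k)) : Prop where
  isClosedImmersion : IsClosedImmersion i
  ker_app : ∀ t : Fin (n + 1), RingHom.ker (i.app (ProjSpace.chart t)).hom =
    (idealAway I t).map (ProjSpace.chartSections t).hom

/-- `i : Z ⟶ ℙⁿ` is (the inclusion of) a hypersurface of degree `d`: the closed subscheme defined
by a nonzero homogeneous polynomial of degree `d`. -/
def IsHypersurface (d : ℕ) {Z : Scheme.{u}} (i : Z ⟶ ProjSpace k n) : Prop :=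
  ∃ F : MvPolynomial (Fin (n + 1)) k,
    F ≠ 0 ∧ F.IsHomogeneous d ∧ IsZeroScheme i (Ideal.span {F})

/-- `j : L ⟶ ℙⁿ⁺¹` is (the inclusion of) a `k`-line: the closed subscheme defined by `n` linearly
independent linear forms with coefficients in `k`. -/
def IsLine {L : Scheme.{u}} (j : L ⟶ ProjSpace k (n + 1)) : Prop :=
  ∃ l : Fin n → MvPolynomial (Fin (n + 2)) k,
    (∀ r, (l r).IsHomogeneous 1) ∧ LinearIndependent k l ∧
      IsZeroScheme j (Ideal.span (Set.range l))

end ProjectiveSpace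

/-! ### Dominant rational maps and their degree -/

section Degree

variable {Y X : Scheme.{u}} [IrreducibleSpace Y] [IrreducibleSpace X]

/-- A dominant rational map sends the generic point to the generic point. -/
lemma fromFunctionField_closedPoint (f : Y ⤏ X) (hf : f.IsDominant) :
    f.fromFunctionField (IsLocalRing.closedPoint Y.functionField) = genericPoint X := by
  obtain ⟨f, rfl⟩ := f.exists_rep
  have hd : IsDominant f.hom := (Scheme.PartialMap.isDominant_toRationalMap_iff f).mp hf
  have hη : genericPoint Y ∈ f.domain :=
    (genericPoint_specializes _).mem_open f.domain.2 f.dense_domain.nonempty.choose_spec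
  let ξ : f.domain.toScheme := f.domain.fromSpecStalkOfMem (genericPoint Y) hη
    (IsLocalRing.closedPoint Y.functionField)
  have hξ : f.domain.ι ξ = genericPoint Y := by
    have h := congrArg (fun φ : Spec (Y.presheaf.stalk (genericPoint Y)) ⟶ Y ↦
      φ (IsLocalRing.closedPoint (Y.presheaf.stalk (genericPoint Y))))
      (Scheme.Opens.fromSpecStalkOfMem_ι f.domain (genericPoint Y) hη)
    exact h.trans Scheme.fromSpecStalk_closedPoint
  have h1 : IsGenericPoint ξ Set.univ := by
    refine isGenericPoint_def.mpr (Set.eq_univ_of_forall fun y ↦ ?_)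
    rw [← specializes_iff_mem_closure, ← f.domain.ι.isOpenEmbedding.isInducing.specializes_iff, hξ]
    exact genericPoint_specializes _
  have h2 : IsGenericPoint (f.hom ξ) Set.univ := by
    have := h1.image f.hom.continuous
    rwa [Set.image_univ, f.hom.denseRange.closure_range] at this
  exact h2.eq (genericPoint_spec X)

/-- The homomorphism of function fields `K(X) ⟶ K(Y)` induced by a dominant rational map
`Y ⤏ X`: the stalk at the generic point of `X` maps to `K(Y)` by pulling back along
`Spec K(Y) ⟶ X`. -/
def functionFieldMap (f : Y ⤏ X) (hf : f.IsDominant) : X.functionField ⟶ Y.functionField :=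
  X.presheaf.stalkSpecializes (specializes_of_eq (fromFunctionField_closedPoint f hf)) ≫
    Scheme.stalkClosedPointTo f.fromFunctionField

/-- The degree `[K(Y) : K(X)]` of a dominant rational map `Y ⤏ X`
(with value `0` if the extension is infinite). -/
def degree (f : Y ⤏ X) (hf : f.IsDominant) : ℕ :=
  @Module.finrank X.functionField Y.functionField _ _
    (functionFieldMap f hf).hom.toAlgebra.toModule

end Degree

/-- A unirational parameterization of degree `d` of an integral `k`-scheme `X` of finite type with
structure morphism `sX`: a dominant rational map `ℙⁿ ⤏ X` over `k` whose function field extension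
is finite, with `[k(ℙⁿ) : k(X)] = d` (so that necessarily `n = dim X`). -/
def IsUnirationalParameterization {k : Type u} [Field k] {n : ℕ} {X : Scheme.{u}} [IsIntegral X]
    (sX : X ⟶ Spec (CommRingCat.of k)) (d : ℕ) (f : ProjSpace k n ⤏ X) : Prop :=
  0 < d ∧ f.compHom sX = (ProjSpace.toBase k n).toRationalMap ∧ ∃ hf : f.IsDominant, degree f hf = d

end CubicUnirational

end

/-!
The parametrization is the classical one by tangent directions along the line, in a form which works
over every field. Choose homogeneous coordinates `s, t, y₁, …, yₙ` in which the line is `y = 0`. The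
cubic form is then `s² C + s t B + t² A + s Q₁ + t Q₀ + G` with `A, B, C` linear, `Q₀, Q₁` quadratic
and `G` cubic in `y` (`LineCubic`), and the plane through the line and the point `y` meets the cubic
in the line and in a residual conic. Smoothness enters in two ways. At no geometric point of the
line do all partial derivatives vanish, so that the line meets the general residual conic in points
which are not rational over the field of rational functions in `y` (`LineCubic.quadratic_ne_zero`).
Moreover, the general residual conic is nonsingular, since otherwise the singular points of the
conics would be singular points of the cubic (`LineCubic.disc_ne_zero`; characteristic two needs a
separate argument).

A general point `u` of the line lies on the residual conics of the planes in a hyperplane of the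
space of planes through the line, and the residual conic of such a plane is parametrized rationally
by the lines through `u` in the plane; let `m` be the parameter of these lines. The point `u`, the
plane and `m` are `n` independent parameters `z`, and the resulting point `(s : t : y)` of the cubic
has coordinates in `k(z)` (`LineCubic.exists_generic_point`). Conversely, the point `(s : t : y)`
determines the plane, and `u` is one of the two points in which its residual conic meets the line,
so that `k(z)` is generated over the function field of the cubic by a root of a quadratic
polynomial. That its degree is not one is proved with the field `L` generated by `y` and `t`: both
`s` and `u` are quadratic over `L`, and `s` is not in `L(u)`, because otherwise the residual conic
would contain a line (`discriminant_eq_zero_of_mem_adjoin`, `finrank_eq_two_of_quadratic`). The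
forms which vanish at `(s : t : y)` are the multiples of the cubic form
(`LineCubic.poly_dvd_of_aeval_eq_zero`). These facts are collected in `hasDoubleParam_of_line`.

To pass to schemes, smoothness of a chart is used through infinitesimal lifting: a section of
`k[x] / (f²) → k[x] / (f)` excludes singular zeros of `f` (`exists_aeval_pderiv_ne_zero`). The
point `(s : t : y)` is a morphism from the spectrum of the function field of `ℙⁿ` to the cubic which
is injective on the functions of each chart. Hence the cubic is integral, the point is its generic
point, and it spreads out to a dominant rational map whose degree is computed by the ratios of the
coordinates (`IsZeroScheme.exists_isUnirationalParameterization`).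
-/

namespace CubicUnirational

/-! ### Homogeneous polynomials -/

theorem aeval_mul_of_isHomogeneous {σ k B : Type*} [CommSemiring k] [CommSemiring B] [Algebra k B]
    {G : MvPolynomial σ k} {d : ℕ} (hG : G.IsHomogeneous d) (c : B) (w : σ → B) :
    aeval (fun i ↦ c * w i) G = c ^ d * aeval w G := by
  simp only [aeval_def, eval₂_eq, Finset.mul_sum]
  refine Finset.sum_congr rfl fun e he ↦ ?_
  have hd : ∑ i ∈ e.support, e i = d := by
    rw [← Finsupp.degree_apply]
    exact (hG.degree_eq_sum_deg_support he).symm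
  simp only [mul_pow, Finset.prod_mul_distrib]
  rw [Finset.prod_pow_eq_pow_sum, hd]
  ring

/-- A homogeneous polynomial is determined by its dehomogenization. -/
theorem IsHomogeneous.eq_zero_of_aeval_eq_zero {σ k B : Type*} [Field k] [CommRing B]
    [Algebra k B] {G : MvPolynomial σ k} {d : ℕ} (hG : G.IsHomogeneous d) (i : σ) (w : σ → B)
    (hi : w i = 1) (hw : AlgebraicIndependent k fun j : {j // j ≠ i} ↦ w j)
    (h0 : aeval w G = 0) : G = 0 := by
  classical
  let δ : σ → MvPolynomial {j // j ≠ i} k := fun j ↦ if h : j = i then 1 else X ⟨j, h⟩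
  have hδ : aeval δ G = 0 := by
    refine hw ?_
    rw [← AlgHom.comp_apply, comp_aeval, map_zero, ← h0]
    congr 2
    funext j
    by_cases h : j = i
    · simp [δ, h, hi]
    · simp [δ, h]
  have hX : algebraMap (MvPolynomial σ k) (FractionRing (MvPolynomial σ k)) (X i) ≠ 0 := by simp
  -- substituting `Xⱼ / Xᵢ` recovers `G` up to a power of `Xᵢ`
  have key : aeval (fun j ↦ (algebraMap (MvPolynomial σ k) (FractionRing (MvPolynomial σ k))
      (X i))⁻¹ *
      algebraMap (MvPolynomial σ k) (FractionRing (MvPolynomial σ k)) (X j)) G = 0 := by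
    have := congrArg (aeval fun j : {j // j ≠ i} ↦
      (algebraMap (MvPolynomial σ k) (FractionRing (MvPolynomial σ k)) (X i))⁻¹ *
      algebraMap (MvPolynomial σ k) (FractionRing (MvPolynomial σ k)) (X j.1)) hδ
    rw [← AlgHom.comp_apply, comp_aeval, map_zero] at this
    rw [← this]
    congr 2
    funext j
    by_cases h : j = i
    · simp [δ, h, hX]
    · simp [δ, h]
  rw [aeval_mul_of_isHomogeneous hG, mul_eq_zero] at key
  have h1 := key.resolve_left (pow_ne_zero _ (inv_ne_zero hX))
  have h2 := aeval_algebraMap_apply (FractionRing (MvPolynomial σ k)) (X : σ → MvPolynomial σ k) G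
  rw [aeval_X_left_apply] at h2
  exact (map_eq_zero_iff _ (IsFractionRing.injective (MvPolynomial σ k)
    (FractionRing (MvPolynomial σ k)))).mp (h2.symm.trans h1)

/-- If `r / s` is a root of `p x² + b x + a`, then `p r / s` is integral. -/
theorem dvd_mul_of_quadratic {R : Type*} [CommRing R] [IsDomain R] [IsIntegrallyClosed R]
    {p a b r s : R} (hs : s ≠ 0) (h : p * r ^ 2 + b * r * s + a * s ^ 2 = 0) : s ∣ p * r := by
  have hs' : algebraMap R (FractionRing R) s ≠ 0 := by simpa using hs
  have hint : IsIntegral R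
      (algebraMap R (FractionRing R) (p * r) / algebraMap R (FractionRing R) s) := by
    refine ⟨Polynomial.X ^ 2 + Polynomial.C b * Polynomial.X + Polynomial.C (p * a), ?_, ?_⟩
    · monicity!
    · have := congrArg (algebraMap R (FractionRing R)) h
      simp only [map_add, map_mul, map_pow, map_zero] at this
      simp only [Polynomial.eval₂_add, Polynomial.eval₂_mul, Polynomial.eval₂_pow,
        Polynomial.eval₂_X, Polynomial.eval₂_C, map_mul]
      field_simp
      linear_combination (algebraMap R (FractionRing R) p) * this
  obtain ⟨v, hv⟩ := IsIntegrallyClosed.isIntegral_iff.mp hint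
  refine ⟨v, IsFractionRing.injective R (FractionRing R) ?_⟩
  rw [map_mul _ s, hv, mul_div_cancel₀ _ hs']

/-- If `p` is prime in an integrally closed domain and `p x² + b x + a` has a root in the fraction
field, then it has a root in the ring itself: `p x` is integral for each of the two roots, and `p`
divides one of the two resulting elements. -/
theorem exists_root_of_prime_leadingCoeff {R : Type*} [CommRing R] [IsDomain R]
    [IsIntegrallyClosed R] {p a b r s : R} (hp : Prime p) (hs : s ≠ 0)
    (h : p * r ^ 2 + b * r * s + a * s ^ 2 = 0) : ∃ c, p * c ^ 2 + b * c + a = 0 := by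
  obtain ⟨v, hv⟩ := dvd_mul_of_quadratic hs h
  have hq : v * (v + b) = -(p * a) := by
    refine mul_left_cancel₀ (pow_ne_zero 2 hs) ?_
    linear_combination (-(s * v) - p * r - b * s) * hv + p * h
  rcases hp.dvd_or_dvd (show p ∣ v * (v + b) from hq ▸ (Dvd.intro _ rfl).neg_right)
    with ⟨c, rfl⟩ | ⟨c, hc⟩
  · refine ⟨c, mul_left_cancel₀ hp.ne_zero ?_⟩
    linear_combination hq
  · refine ⟨-c, mul_left_cancel₀ hp.ne_zero ?_⟩
    obtain rfl : v = p * c - b := by linear_combination hc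
    linear_combination hq

/-- A quadratic polynomial over `k[X]` with leading coefficient a variable and with coefficients of
degree at most one which has a root in the fraction field has a constant root, by comparison of
degrees. -/
theorem exists_const_root {σ k : Type*} [Field k] {i : σ} {a b r s : MvPolynomial σ k}
    (ha : a.totalDegree ≤ 1) (hb : b.totalDegree ≤ 1) (hs : s ≠ 0)
    (h : X i * r ^ 2 + b * r * s + a * s ^ 2 = 0) :
    ∃ c : k, X i * C c ^ 2 + b * C c + a = 0 := by
  obtain ⟨c, hc⟩ := exists_root_of_prime_leadingCoeff X_prime hs h
  by_cases h0 : c = 0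
  · exact ⟨0, by simpa [h0] using hc⟩
  have hdeg : (X i * c ^ 2 : MvPolynomial σ k).totalDegree = 1 + 2 * c.totalDegree := by
    rw [totalDegree_mul_of_isDomain (X_ne_zero i) (pow_ne_zero 2 h0), totalDegree_X, pow_two,
      totalDegree_mul_of_isDomain h0 h0, two_mul]
  have hle : (X i * c ^ 2 : MvPolynomial σ k).totalDegree ≤ 1 + c.totalDegree := by
    rw [show X i * c ^ 2 = -(b * c + a) by linear_combination hc, totalDegree_neg]
    refine (totalDegree_add _ _).trans (max_le ((totalDegree_mul _ _).trans ?_) ?_) <;> omega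
  have : c.totalDegree = 0 := by omega
  rw [totalDegree_eq_zero_iff_eq_C] at this
  exact ⟨_, this ▸ hc⟩

/-! ### Field theory -/

open IntermediateField in
open scoped IntermediateField.algebraAdjoinAdjoin in
/-- If `n` elements of a purely transcendental extension of transcendence degree `n` are such that
the whole extension is algebraic over them, then they are algebraically independent. -/
theorem algebraicIndependent_of_isAlgebraic {k K ι : Type*} [Finite ι] [Field k] [Field K]
    [Algebra k K] {z : ι → K} (hz : AlgebraicIndependent k z)
    (hgen : adjoin k (Set.range z) = ⊤) (x : ι → K)
    (hx : ∀ i, IsAlgebraic (adjoin k (Set.range x)) (z i)) : AlgebraicIndependent k x := by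
  have h1 : Algebra.IsAlgebraic (adjoin k (Set.range x)) K := by
    rw [← algebraicClosure.eq_top_iff, ← restrictScalars_eq_top_iff (K := k), eq_top_iff, ← hgen,
      adjoin_le_iff]
    rintro _ ⟨i, rfl⟩
    exact mem_algebraicClosure_iff.mpr (hx i)
  have h2 : Algebra.IsAlgebraic (Algebra.adjoin k (Set.range x)) K := by
    rwa [IsFractionRing.comap_isAlgebraic_iff (K := adjoin k (Set.range x))]
  exact (Algebra.IsAlgebraic.isTranscendenceBasis_of_lift_le_trdeg_of_finite k x
    hz.lift_cardinalMk_le_trdeg).1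

theorem aeval_mem_of_forall_mem {k K σ : Type*} [Field k] [Field K] [Algebra k K]
    {L : IntermediateField k K} {w : σ → K}
    (hw : ∀ j, w j ∈ L) (p : MvPolynomial σ k) : aeval w p ∈ L := by
  have h3 : Algebra.adjoin k (Set.range w) ≤ L.toSubalgebra :=
    Algebra.adjoin_le (Set.range_subset_iff.mpr hw)
  refine h3 ?_
  rw [Algebra.adjoin_range_eq_range_aeval]
  exact ⟨p, rfl⟩

theorem isAlgebraic_of_quadratic {k K : Type*} [Field k] [Field K] [Algebra k K] {x a b c : K}
    (ha : IsAlgebraic k a) (hb : IsAlgebraic k b) (hc : IsAlgebraic k c) (hc0 : c ≠ 0)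
    (h : c * x ^ 2 + b * x + a = 0) : IsAlgebraic k x := by
  let M := algebraicClosure k K
  have : IsAlgebraic M x := by
    refine ⟨Polynomial.C (⟨c, mem_algebraicClosure_iff.mpr hc⟩ : M) * Polynomial.X ^ 2 +
      Polynomial.C (⟨b, mem_algebraicClosure_iff.mpr hb⟩ : M) * Polynomial.X +
      Polynomial.C (⟨a, mem_algebraicClosure_iff.mpr ha⟩ : M), fun h0 ↦ hc0 ?_, ?_⟩
    · simpa using congrArg (fun p ↦ ((p.coeff 2 : M) : K)) h0
    · simpa using h
  exact this.restrictScalars k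

open IntermediateField Polynomial in
/-- A plane conic of nonzero discriminant has no rational point over `k(t)` whose first coordinate
is the transcendental `t`: the other coordinate would be a polynomial in `t`, hence a linear one, so
that the conic would contain a line. -/
theorem discriminant_eq_zero_of_mem_adjoin {k K : Type*} [Field k] [Field K] [Algebra k K]
    {t s : K} (ht : Transcendental k t) (hs : s ∈ k⟮t⟯) {a b c q₀ q₁ g : k} (hc : c ≠ 0)
    (h : algebraMap k K c * s ^ 2 + (algebraMap k K b * t + algebraMap k K q₁) * s +
      (algebraMap k K a * t ^ 2 + algebraMap k K q₀ * t + algebraMap k K g) = 0) :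
    4 * a * c * g + b * q₀ * q₁ - a * q₁ ^ 2 - c * q₀ ^ 2 - g * b ^ 2 = 0 := by
  obtain ⟨p, hp⟩ : ∃ p : k[X], aeval t p = s := by
    obtain ⟨r, d, rfl⟩ := (mem_adjoin_simple_iff k s).mp hs
    by_cases hd : d = 0
    · exact ⟨0, by simp [hd]⟩
    have hd' : Polynomial.aeval t d ≠ 0 := fun h0 ↦ ht ⟨d, hd, h0⟩
    have e : Polynomial.C c * r ^ 2 + (Polynomial.C b * Polynomial.X + Polynomial.C q₁) * r * d +
        (Polynomial.C a * Polynomial.X ^ 2 + Polynomial.C q₀ * Polynomial.X + Polynomial.C g) *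
          d ^ 2 = 0 := by
      by_contra hne
      refine ht ⟨_, hne, ?_⟩
      field_simp at h
      simp only [map_add, map_mul, map_pow, Polynomial.aeval_C, Polynomial.aeval_X]
      linear_combination h
    obtain ⟨v, hv⟩ := dvd_mul_of_quadratic hd e
    refine ⟨Polynomial.C c⁻¹ * v, ?_⟩
    have hc' : algebraMap k K c ≠ 0 := by simpa using hc
    have := congrArg (Polynomial.aeval t) hv
    simp only [map_mul, Polynomial.aeval_C, map_inv₀] at this ⊢
    field_simp
    linear_combination -this
  have hq : Polynomial.C c * p ^ 2 + (Polynomial.C b * Polynomial.X + Polynomial.C q₁) * p +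
      (Polynomial.C a * Polynomial.X ^ 2 + Polynomial.C q₀ * Polynomial.X + Polynomial.C g) = 0 := by
    by_contra hne
    exact ht ⟨_, hne, by simpa [hp] using h⟩
  have hdeg : p.natDegree ≤ 1 := by
    by_contra! hd
    have h0 : p ≠ 0 := by rintro rfl; simp at hd
    have h1 : (Polynomial.C c * p ^ 2).natDegree = 2 * p.natDegree := by
      rw [natDegree_C_mul hc, natDegree_pow]
    have h2 : (Polynomial.C c * p ^ 2).natDegree ≤ 1 + p.natDegree := by
      rw [show Polynomial.C c * p ^ 2 = -((Polynomial.C b * Polynomial.X +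
          Polynomial.C q₁) * p + (Polynomial.C a * Polynomial.X ^ 2 +
            Polynomial.C q₀ * Polynomial.X +
            Polynomial.C g)) by
        linear_combination hq, natDegree_neg]
      refine natDegree_add_le_of_degree_le (natDegree_mul_le.trans ?_) ?_
      · gcongr; exact natDegree_linear_le
      · exact natDegree_quadratic_le.trans (by omega)
    omega
  obtain ⟨β, γ, rfl⟩ := exists_eq_X_add_C_of_natDegree_le_one hdeg
  have e : Polynomial.C (c * β ^ 2 + b * β + a) * Polynomial.X ^ 2 + Polynomial.C (2 * c * β * γ +
      b * γ + q₁ * β + q₀) * Polynomial.X +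
      Polynomial.C (c * γ ^ 2 + q₁ * γ + g) = 0 := by
    rw [← hq]
    simp only [map_add, map_mul, map_pow, map_ofNat]
    ring
  have hcoeff : ∀ x y z : k, Polynomial.C x * Polynomial.X ^ 2 + Polynomial.C y * Polynomial.X +
      Polynomial.C z = 0 → x = 0 ∧ y = 0 ∧ z = 0 := fun x y z h0 ↦
    ⟨by simpa using congrArg (Polynomial.coeff · 2) h0,
      by simpa using congrArg (Polynomial.coeff · 1) h0,
      by simpa using congrArg (Polynomial.coeff · 0) h0⟩
  obtain ⟨e2, e1, e0⟩ := hcoeff _ _ _ e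
  obtain rfl : g = -(c * γ ^ 2 + q₁ * γ) := by linear_combination e0
  obtain rfl : q₀ = -(2 * c * β * γ + b * γ + q₁ * β) := by linear_combination e1
  obtain rfl : a = -(c * β ^ 2 + b * β) := by linear_combination e2
  ring

open IntermediateField in
/-- The elements of a field generated by a root of a quadratic polynomial are linear in it. -/
theorem exists_eq_add_mul_of_mem_adjoin {k K : Type*} [Field k] [Field K] [Algebra k K]
    {x y : K} {a b : k} (h : x ^ 2 + algebraMap k K b * x + algebraMap k K a = 0)
    (hy : y ∈ k⟮x⟯) : ∃ c d : k, y = algebraMap k K c + algebraMap k K d * x := by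
  open Polynomial in
  have hm : (Polynomial.X ^ 2 + Polynomial.C b * Polynomial.X + Polynomial.C a : k[X]).Monic :=
      by monicity!
  have hm2 : (Polynomial.X ^ 2 + Polynomial.C b * Polynomial.X + Polynomial.C a : k[X]).natDegree =
      2 := by compute_degree!
  have hx : IsIntegral k x := ⟨_, hm, by simpa [Polynomial.aeval_def] using h⟩
  have : y ∈ Algebra.adjoin k {x} := by
    rwa [← IntermediateField.mem_toSubalgebra,
      IntermediateField.adjoin_simple_toSubalgebra_of_isAlgebraic hx.isAlgebraic] at hy
  obtain ⟨p, rfl⟩ := Algebra.adjoin_mem_exists_aeval k x this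
  have hd : (p %ₘ (Polynomial.X ^ 2 + Polynomial.C b * Polynomial.X +
      Polynomial.C a)).natDegree ≤ 1 := by
    have := natDegree_modByMonic_lt p hm (by rintro h; simp [h] at hm2)
    omega
  obtain ⟨d, c, hdc⟩ := exists_eq_X_add_C_of_natDegree_le_one hd
  refine ⟨c, d, ?_⟩
  conv_lhs => rw [← modByMonic_add_div p (Polynomial.X ^ 2 + Polynomial.C b * Polynomial.X +
    Polynomial.C a), hdc]
  simp [h]
  ring

open IntermediateField in
/-- If `u` and `s` are quadratic over `k` and `s ∉ k(u)`, then `k(s, u)` has degree two over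
`k(s)`. -/
theorem finrank_eq_two_of_quadratic {k K : Type*} [Field k] [Field K] [Algebra k K]
    {u s : K} {a b c d : k} (hu : u ^ 2 + algebraMap k K b * u + algebraMap k K a = 0)
    (hs : s ^ 2 + algebraMap k K d * s + algebraMap k K c = 0)
    (hu' : u ∉ Set.range (algebraMap k K)) (hs' : s ∉ k⟮u⟯)
    (E : IntermediateField k K) (hE : E = k⟮s⟯) (htop : E⟮u⟯ = ⊤) : Module.finrank E K = 2 := by
  subst hE
  have huE : u ∉ Set.range (algebraMap k⟮s⟯ K) := by
    rintro ⟨⟨u', hmem⟩, rfl⟩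
    change s ∉ k⟮u'⟯ at hs'
    change u' ∉ _ at hu'
    obtain ⟨e, f, hef⟩ := exists_eq_add_mul_of_mem_adjoin hs hmem
    have hf : f ≠ 0 := by
      rintro rfl
      exact hu' ⟨e, by simpa using hef.symm⟩
    refine hs' ?_
    have hf' : algebraMap k K f ≠ 0 := by simpa using hf
    have : s = (algebraMap k K f)⁻¹ * (u' - algebraMap k K e) := by
      rw [hef]; field_simp; ring
    rw [this]
    exact mul_mem (inv_mem (_root_.algebraMap_mem _ _)) (sub_mem (mem_adjoin_simple_self _ _)
      (_root_.algebraMap_mem _ _))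
  open Polynomial in
  let P : (k⟮s⟯)[X] := Polynomial.X ^ 2 + Polynomial.C (algebraMap k _ b) * Polynomial.X +
      Polynomial.C (algebraMap k _ a)
  have hm : P.Monic := by simp only [P]; monicity!
  have hm2 : P.natDegree = 2 := by simp only [P]; compute_degree!
  have hP : aeval u P = 0 := by simpa [P] using hu
  have hint : IsIntegral k⟮s⟯ u := ⟨P, hm, by simpa [Polynomial.aeval_def] using hP⟩
  have h1 : (minpoly k⟮s⟯ u).natDegree ≤ 2 := hm2 ▸ natDegree_le_of_dvd (minpoly.dvd _ _ hP)
      hm.ne_zero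
  have h2 : 2 ≤ (minpoly k⟮s⟯ u).natDegree := (minpoly.two_le_natDegree_iff hint).mpr huE
  rw [← finrank_top', ← htop, adjoin.finrank hint]
  omega

/-! ### Systems of fewer equations than unknowns -/

/-- The maximal ideal of the origin has height at least `N`: setting one variable after the other to
zero gives a chain of prime ideals. -/
theorem le_height_ker_aeval_zero (k : Type*) [Field k] (N : ℕ) :
    (N : ℕ∞) ≤ (RingHom.ker (aeval (0 : Fin N → k) : MvPolynomial (Fin N) k →ₐ[k] k)).height := by
  let δ : ℕ → Fin N → MvPolynomial (Fin N) k := fun i j ↦ if j.1 < i then 0 else X j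
  let p : ℕ → Ideal (MvPolynomial (Fin N) k) := fun i ↦ RingHom.ker (aeval (δ i))
  have hp : ∀ i, (p i).IsPrime := fun i ↦ RingHom.ker_isPrime _
  have hle : ∀ i, p i ≤ p (i + 1) := fun i x hx ↦ by
    have : (aeval (δ (i + 1))).comp (aeval (δ i)) = aeval (δ (i + 1)) := by
      ext j : 1
      by_cases hj : j.1 < i
      · simp [δ, hj, show ¬ i < j.1 by omega]
      · simp [δ, hj]
    rw [RingHom.mem_ker] at hx ⊢
    rw [← this, AlgHom.comp_apply, hx, map_zero]
  have hlt : ∀ i < N, p i < p (i + 1) := fun i hi ↦ by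
    refine lt_of_le_of_ne (hle i) fun h ↦ ?_
    have : X ⟨i, hi⟩ ∈ p (i + 1) := by simp [p, δ, RingHom.mem_ker]
    rw [← h] at this
    simp [p, δ, RingHom.mem_ker] at this
  have hh : ∀ i ≤ N, (i : ℕ∞) ≤ (p i).height := by
    intro i
    induction i with
    | zero => simp
    | succ i ih =>
      intro hi
      have := Ideal.height_add_one_le_of_lt_of_isPrime (hlt i (by omega))
      refine le_trans ?_ this
      push_cast
      gcongr
      exact ih (by omega)
  refine (hh N le_rfl).trans (Ideal.height_mono fun x hx ↦ ?_)
  have : (aeval (0 : Fin N → k)).comp (aeval (δ N)) = aeval (0 : Fin N → k) := by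
    ext j : 1
    simp [δ]
  rw [RingHom.mem_ker] at hx ⊢
  rw [← this, AlgHom.comp_apply, hx, map_zero]

/-- Fewer equations without constant term than unknowns have a nonzero common solution in some
field extension, by Krull's height theorem. -/
theorem exists_ne_zero_of_card_lt {k : Type u} [Field k] {n N : ℕ} (hnN : n < N)
    (g : Fin n → MvPolynomial (Fin N) k) (hg : ∀ i, aeval (0 : Fin N → k) (g i) = 0) :
    ∃ (Ω : Type u) (_ : Field Ω) (_ : Algebra k Ω) (w : Fin N → Ω),
      w ≠ 0 ∧ ∀ i, aeval w (g i) = 0 := by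
  have : (RingHom.ker (aeval (0 : Fin N → k) : MvPolynomial (Fin N) k →ₐ[k] k)).IsPrime :=
    RingHom.ker_isPrime _
  obtain ⟨p, hp, hle⟩ := Ideal.exists_minimalPrimes_le (I := Ideal.span (Set.range g))
    (J := RingHom.ker (aeval (0 : Fin N → k) : MvPolynomial (Fin N) k →ₐ[k] k)) (by
      rw [Ideal.span_le]
      rintro _ ⟨i, rfl⟩
      exact hg i)
  have hprime : p.IsPrime := hp.1.1
  have hht : p.height ≤ n := by
    refine (Ideal.height_le_card_of_mem_minimalPrimes_span (Set.finite_range g) hp).trans ?_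
    have : (Set.range g).ncard ≤ n := by
      have := Set.ncard_image_le (f := g) (s := Set.univ) (Set.toFinite _)
      rwa [Set.image_univ, Set.ncard_univ, Nat.card_eq_fintype_card, Fintype.card_fin] at this
    exact_mod_cast this
  refine ⟨FractionRing (MvPolynomial (Fin N) k ⧸ p), inferInstance, inferInstance,
    fun j ↦ algebraMap _ _ (Ideal.Quotient.mk p (X j)), fun h0 ↦ ?_, fun i ↦ ?_⟩
  · have hX : ∀ j, X j ∈ p := fun j ↦ by
      have := congrFun h0 j
      simpa [Ideal.Quotient.eq_zero_iff_mem] using this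
    have hker : RingHom.ker (aeval (0 : Fin N → k) : MvPolynomial (Fin N) k →ₐ[k] k) ≤ p := by
      intro x hx
      have h1 : (Ideal.Quotient.mkₐ k p).comp ((Algebra.ofId k (MvPolynomial (Fin N) k)).comp
          (aeval (0 : Fin N → k))) = Ideal.Quotient.mkₐ k p := by
        ext j : 1
        simpa [eq_comm (a := (0 : MvPolynomial (Fin N) k ⧸ p)), Ideal.Quotient.eq_zero_iff_mem]
          using hX j
      have h2 := congrArg (fun φ ↦ φ x) h1
      rw [RingHom.mem_ker] at hx
      simp only [AlgHom.comp_apply, hx, map_zero] at h2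
      exact Ideal.Quotient.eq_zero_iff_mem.mp h2.symm
    have := (le_height_ker_aeval_zero k N).trans ((Ideal.height_mono hker).trans hht)
    exact absurd (by exact_mod_cast this) (not_le.mpr hnN)
  · have h1 : (aeval fun j ↦ algebraMap (MvPolynomial (Fin N) k ⧸ p)
        (FractionRing (MvPolynomial (Fin N) k ⧸ p)) (Ideal.Quotient.mk p (X j))) =
        (IsScalarTower.toAlgHom k (MvPolynomial (Fin N) k ⧸ p) _).comp
          (Ideal.Quotient.mkₐ k p) := by
      ext j : 1
      simp
    rw [h1, AlgHom.comp_apply]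
    have : Ideal.Quotient.mkₐ k p (g i) = 0 :=
      Ideal.Quotient.eq_zero_iff_mem.mpr (hp.1.2 (Ideal.subset_span ⟨i, rfl⟩))
    rw [this, map_zero]

/-! ### Nonsingular polynomials -/

/-- A polynomial is nonsingular if the hypersurface that it defines has no singular point, other
than possibly the origin, with coordinates in any extension field. -/
def IsNonsingular {σ : Type*} {k : Type u} [Field k] (F : MvPolynomial σ k) : Prop :=
  ∀ (Ω : Type u) [Field Ω] [Algebra k Ω] (w : σ → Ω),
    aeval w F = 0 → (∀ a, aeval w (pderiv a F) = 0) → w = 0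

theorem IsNonsingular.eq_zero {σ : Type*} {k : Type u} [Field k] {F : MvPolynomial σ k}
    (hF : IsNonsingular F) {R : Type u} [CommRing R] [IsDomain R] [Algebra k R] (w : σ → R)
    (h0 : aeval w F = 0) (h1 : ∀ a, aeval w (pderiv a F) = 0) : w = 0 := by
  have := hF (FractionRing R) (fun i ↦ algebraMap R (FractionRing R) (w i))
    (by rw [show (fun i ↦ algebraMap R (FractionRing R) (w i)) = algebraMap R (FractionRing R) ∘ w
          from rfl, aeval_algebraMap_apply, h0, map_zero])
    (fun a ↦ by rw [show (fun i ↦ algebraMap R (FractionRing R) (w i)) =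
          algebraMap R (FractionRing R) ∘ w from rfl, aeval_algebraMap_apply, h1, map_zero])
  funext i
  exact IsFractionRing.injective R (FractionRing R) (by simpa using congrFun this i)

/-! ### Cubic forms vanishing on a coordinate line -/

/-- The linear form with coefficients `a`. -/
noncomputable def linForm {k : Type*} [Field k] {n : ℕ} (a : Fin n → k) : MvPolynomial (Fin n) k :=
  ∑ j, C (a j) * X j

theorem linForm_isHomogeneous {k : Type*} [Field k] {n : ℕ} (a : Fin n → k) :
    (linForm a).IsHomogeneous 1 :=
  IsHomogeneous.sum _ _ _ fun j _ ↦ isHomogeneous_C_mul_X (a j) j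

theorem aeval_linForm {k B : Type*} [Field k] [CommRing B] [Algebra k B] {n : ℕ} (a : Fin n → k)
    (w : Fin n → B) : aeval w (linForm a) = ∑ j, algebraMap k B (a j) * w j := by
  simp [linForm]

theorem pderiv_linForm {k : Type*} [Field k] {n : ℕ} (a : Fin n → k) (j : Fin n) :
    pderiv j (linForm a) = C (a j) := by
  simp [linForm, pderiv_X, Pi.single_apply]

/-- A cubic form in the variables `s, t, y₁, …, yₙ` which vanishes on the line `y = 0`, written as
`s² C + s t B + t² A + s Q₁ + t Q₀ + G` with forms `A, B, C` (linear), `Q₀, Q₁` (quadratic) and `G`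
(cubic) in `y`; the linear forms are recorded by their coefficients. -/
structure LineCubic (k : Type u) [Field k] (n : ℕ) where
  (a b c : Fin n → k)
  (q₀ q₁ g : MvPolynomial (Fin n) k)
  hq₀ : q₀.IsHomogeneous 2
  hq₁ : q₁.IsHomogeneous 2
  hg : g.IsHomogeneous 3

namespace LineCubic

variable {k : Type u} [Field k] {n : ℕ} (D : LineCubic k n)

/-- The cubic form, with `s` and `t` the variables of index `0` and `1`. -/
noncomputable def poly : MvPolynomial (Fin (n + 2)) k :=
  X 0 ^ 2 * rename (fun j ↦ j.succ.succ) (linForm D.c) +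
    X 0 * X 1 * rename (fun j ↦ j.succ.succ) (linForm D.b) +
    X 1 ^ 2 * rename (fun j ↦ j.succ.succ) (linForm D.a) +
    X 0 * rename (fun j ↦ j.succ.succ) D.q₁ + X 1 * rename (fun j ↦ j.succ.succ) D.q₀ +
    rename (fun j ↦ j.succ.succ) D.g

/-- The discriminant of the conic in which the cubic meets the plane spanned by the line and the
point `(0 : 0 : y)`, apart from the line. -/
noncomputable def disc : MvPolynomial (Fin n) k :=
  4 * linForm D.a * linForm D.c * D.g + linForm D.b * D.q₀ * D.q₁ - linForm D.a * D.q₁ ^ 2 -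
    linForm D.c * D.q₀ ^ 2 - D.g * linForm D.b ^ 2

theorem disc_isHomogeneous : D.disc.IsHomogeneous 5 := by
  have ha := linForm_isHomogeneous D.a
  have hb := linForm_isHomogeneous D.b
  have hc := linForm_isHomogeneous D.c
  have h4 : (4 : MvPolynomial (Fin n) k).IsHomogeneous 0 := by
    rw [show (4 : MvPolynomial (Fin n) k) = C 4 from (map_ofNat C 4).symm]
    exact isHomogeneous_C _ _
  exact (((((h4.mul ha).mul hc).mul D.hg).add ((hb.mul D.hq₀).mul D.hq₁)).sub
    (ha.mul (D.hq₁.pow 2))).sub (hc.mul (D.hq₀.pow 2)) |>.sub (D.hg.mul (hb.pow 2))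

theorem isHomogeneous_poly : D.poly.IsHomogeneous 3 := by
  have hX := fun i : Fin (n + 2) ↦ isHomogeneous_X k i
  have ha := (linForm_isHomogeneous D.a).rename_isHomogeneous (f := fun j : Fin n ↦ j.succ.succ)
  have hb := (linForm_isHomogeneous D.b).rename_isHomogeneous (f := fun j : Fin n ↦ j.succ.succ)
  have hc := (linForm_isHomogeneous D.c).rename_isHomogeneous (f := fun j : Fin n ↦ j.succ.succ)
  have hq₀ := D.hq₀.rename_isHomogeneous (f := fun j : Fin n ↦ j.succ.succ)
  have hq₁ := D.hq₁.rename_isHomogeneous (f := fun j : Fin n ↦ j.succ.succ)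
  have hg := D.hg.rename_isHomogeneous (f := fun j : Fin n ↦ j.succ.succ)
  exact ((((((hX 0).pow 2).mul hc).add (((hX 0).mul (hX 1)).mul hb)).add
    (((hX 1).pow 2).mul ha)).add ((hX 0).mul hq₁)).add ((hX 1).mul hq₀) |>.add hg

section Eval

variable {B : Type*} [CommRing B] [Algebra k B] (s t : B) (y : Fin n → B)

theorem aeval_rename_succ_succ (p : MvPolynomial (Fin n) k) :
    aeval (Fin.cons s (Fin.cons t y) : Fin (n + 2) → B) (rename (fun j ↦ j.succ.succ) p) =
      aeval y p := by
  rw [aeval_rename]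
  rfl

theorem aeval_poly : aeval (Fin.cons s (Fin.cons t y) : Fin (n + 2) → B) D.poly =
    s ^ 2 * aeval y (linForm D.c) + s * t * aeval y (linForm D.b) + t ^ 2 * aeval y (linForm D.a) +
      s * aeval y D.q₁ + t * aeval y D.q₀ + aeval y D.g := by
  have h1 : (Fin.cons s (Fin.cons t y) : Fin (n + 2) → B) 1 = t := rfl
  simp [poly, aeval_rename_succ_succ, h1]

theorem pderiv_zero_rename (p : MvPolynomial (Fin n) k) :
    pderiv 0 (rename (fun j ↦ (j.succ.succ : Fin (n + 2))) p) = 0 := by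
  refine pderiv_eq_zero_of_notMem_vars fun h ↦ ?_
  obtain ⟨j, -, hj⟩ := Finset.mem_image.mp (vars_rename _ p h)
  exact Fin.succ_ne_zero _ hj

theorem pderiv_one_rename (p : MvPolynomial (Fin n) k) :
    pderiv 1 (rename (fun j ↦ (j.succ.succ : Fin (n + 2))) p) = 0 := by
  refine pderiv_eq_zero_of_notMem_vars fun h ↦ ?_
  obtain ⟨j, -, hj⟩ := Finset.mem_image.mp (vars_rename _ p h)
  rw [← Fin.succ_zero_eq_one, Fin.succ_inj] at hj
  exact Fin.succ_ne_zero _ hj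

theorem pderiv_succ_succ_rename (j : Fin n) (p : MvPolynomial (Fin n) k) :
    pderiv j.succ.succ (rename (fun j ↦ (j.succ.succ : Fin (n + 2))) p) =
      rename (fun j ↦ (j.succ.succ : Fin (n + 2))) (pderiv j p) :=
  pderiv_rename (f := fun j : Fin n ↦ (j.succ.succ : Fin (n + 2)))
    (fun i j h ↦ by simpa using h) j p

theorem aeval_pderiv_zero : aeval (Fin.cons s (Fin.cons t y) : Fin (n + 2) → B) (pderiv 0 D.poly) =
    2 * s * aeval y (linForm D.c) + t * aeval y (linForm D.b) + aeval y D.q₁ := by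
  have h1 : (Fin.cons s (Fin.cons t y) : Fin (n + 2) → B) 1 = t := rfl
  have h2 : pderiv (R := k) (0 : Fin (n + 2)) (X 1) = 0 := pderiv_X_of_ne (by simp)
  simp [poly, aeval_rename_succ_succ, h1, h2, pderiv_zero_rename, Derivation.leibniz_pow]
  ring

theorem aeval_pderiv_one : aeval (Fin.cons s (Fin.cons t y) : Fin (n + 2) → B) (pderiv 1 D.poly) =
    s * aeval y (linForm D.b) + 2 * t * aeval y (linForm D.a) + aeval y D.q₀ := by
  have h1 : (Fin.cons s (Fin.cons t y) : Fin (n + 2) → B) 1 = t := rfl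
  have h2 : pderiv (R := k) (1 : Fin (n + 2)) (X 0) = 0 := pderiv_X_of_ne (by simp)
  simp [poly, aeval_rename_succ_succ, h1, h2, pderiv_one_rename, Derivation.leibniz_pow]
  ring

theorem aeval_pderiv_succ_succ (j : Fin n) :
    aeval (Fin.cons s (Fin.cons t y) : Fin (n + 2) → B) (pderiv j.succ.succ D.poly) =
      s ^ 2 * algebraMap k B (D.c j) + s * t * algebraMap k B (D.b j) +
      t ^ 2 * algebraMap k B (D.a j) + s * aeval y (pderiv j D.q₁) + t * aeval y (pderiv j D.q₀) +
      aeval y (pderiv j D.g) := by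
  have h1 : (Fin.cons s (Fin.cons t y) : Fin (n + 2) → B) 1 = t := rfl
  have h2 : pderiv (R := k) (j.succ.succ) (X 0) = 0 :=
    pderiv_X_of_ne (Fin.succ_ne_zero _).symm
  have h3 : pderiv (R := k) (j.succ.succ) (X 1) = 0 := pderiv_X_of_ne (by
    rw [← Fin.succ_zero_eq_one, Ne, Fin.succ_inj]
    exact (Fin.succ_ne_zero _).symm)
  simp [poly, aeval_rename_succ_succ, h1, h2, h3, pderiv_succ_succ_rename, Derivation.leibniz_pow,
    pderiv_linForm]

end Eval

/-! ### Consequences of nonsingularity -/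

theorem aeval_zero_of_isHomogeneous {σ B : Type*} [CommRing B] [Algebra k B]
    {p : MvPolynomial σ k} {d : ℕ} (hp : p.IsHomogeneous d) (hd : d ≠ 0) :
    aeval (0 : σ → B) p = 0 := by
  have := aeval_mul_of_isHomogeneous hp (0 : B) (0 : σ → B)
  rw [zero_pow hd, zero_mul] at this
  rw [← this]
  congr 2
  funext i
  simp

/-- The tangent space of the cubic at a point of the line is not the whole space. -/
theorem exists_ne_zero (hD : IsNonsingular D.poly) {Ω : Type u} [Field Ω] [Algebra k Ω] {s t : Ω}
    (hst : s ≠ 0 ∨ t ≠ 0) : ∃ j, s ^ 2 * algebraMap k Ω (D.c j) + s * t * algebraMap k Ω (D.b j) +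
      t ^ 2 * algebraMap k Ω (D.a j) ≠ 0 := by
  by_contra! h
  have hz : ∀ l : Fin n → k, aeval (0 : Fin n → Ω) (linForm l) = 0 := fun l ↦
    aeval_zero_of_isHomogeneous (linForm_isHomogeneous l) one_ne_zero
  have h0 := hD Ω (Fin.cons s (Fin.cons t 0)) ?_ ?_
  · have hs : s = 0 := congrFun h0 0
    have ht : t = 0 := congrFun h0 1
    simp [hs, ht] at hst
  · rw [aeval_poly]
    simp only [hz, aeval_zero_of_isHomogeneous D.hq₁ two_ne_zero,
      aeval_zero_of_isHomogeneous D.hq₀ two_ne_zero, aeval_zero_of_isHomogeneous D.hg three_ne_zero]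
    ring
  · intro j
    refine Fin.cases ?_ (fun j ↦ ?_) j
    · rw [aeval_pderiv_zero]
      simp only [hz, aeval_zero_of_isHomogeneous D.hq₁ two_ne_zero]
      ring
    refine Fin.cases ?_ (fun j ↦ ?_) j
    · rw [Fin.succ_zero_eq_one, aeval_pderiv_one]
      simp only [hz, aeval_zero_of_isHomogeneous D.hq₀ two_ne_zero]
      ring
    · rw [aeval_pderiv_succ_succ, h, aeval_zero_of_isHomogeneous D.hq₁.pderiv (by simp),
        aeval_zero_of_isHomogeneous D.hq₀.pderiv (by simp),
        aeval_zero_of_isHomogeneous D.hg.pderiv (by simp)]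
      ring

theorem c_ne_zero (hD : IsNonsingular D.poly) : D.c ≠ 0 := by
  intro hc
  obtain ⟨j, hj⟩ := D.exists_ne_zero hD (Ω := k) (s := 1) (t := 0) (by simp)
  simp [hc] at hj

/-- The points in which the line meets the residual conic in a general plane through it are not
rational over the field of rational functions in the parameters of the plane. -/
theorem quadratic_ne_zero (hD : IsNonsingular D.poly) {τ : Type*} {i : τ}
    {W : Fin n → MvPolynomial τ k} (hW : ∀ j, (W j).totalDegree ≤ 1)
    (hWi : aeval W (linForm D.c) = X i) (hinj : ∀ l : Fin n → k, aeval W (linForm l) = 0 → l = 0)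
    {r s : MvPolynomial τ k} (hs : s ≠ 0) :
    aeval W (linForm D.c) * r ^ 2 + aeval W (linForm D.b) * r * s +
      aeval W (linForm D.a) * s ^ 2 ≠ 0 := by
  intro h
  have hdeg : ∀ l : Fin n → k, (aeval W (linForm l)).totalDegree ≤ 1 := fun l ↦ by
    rw [aeval_linForm]
    refine totalDegree_finsetSum_le fun j _ ↦ (totalDegree_mul _ _).trans ?_
    rw [algebraMap_eq, totalDegree_C, zero_add]
    exact hW j
  rw [hWi] at h
  obtain ⟨x, hx⟩ := exists_const_root (hdeg _) (hdeg _) hs h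
  obtain ⟨j, hj⟩ := D.exists_ne_zero hD (Ω := k) (s := x) (t := 1) (by simp)
  refine hj (congrFun (hinj (fun j ↦ x ^ 2 * D.c j + x * 1 * D.b j + 1 ^ 2 * D.a j) ?_) j)
  rw [← hWi] at hx
  rw [← hx]
  simp only [aeval_linForm, Finset.sum_mul, ← Finset.sum_add_distrib]
  refine Finset.sum_congr rfl fun j _ ↦ ?_
  simp only [algebraMap_eq, map_add, map_mul, map_pow, map_one]
  ring

theorem linForm_ne_zero {l : Fin n → k} (hl : l ≠ 0) : linForm l ≠ 0 := by
  intro h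
  refine hl (funext fun j ↦ ?_)
  have := congrArg (pderiv j) h
  simpa [pderiv_linForm] using this

theorem linForm_single (i : Fin n) : linForm (Pi.single i (1 : k)) = X i := by
  simp [linForm, Pi.single_apply]

/-- The conics in the planes through the line are generically nonsingular: where the discriminant
vanishes identically, the singular points of the conics are singular points of the cubic. -/
theorem disc_ne_zero (hD : IsNonsingular D.poly) {i : Fin n} (hc : D.c = Pi.single i 1) :
    D.disc ≠ 0 := by
  intro h0
  have hC0 : linForm D.c ≠ 0 := linForm_ne_zero (D.c_ne_zero hD)
  have hquad : ∀ r s : MvPolynomial (Fin n) k, s ≠ 0 → linForm D.c * r ^ 2 + linForm D.b * r * s +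
      linForm D.a * s ^ 2 ≠ 0 := fun r s hs ↦ by
    have := D.quadratic_ne_zero hD (W := X) (i := i) (fun j ↦ (totalDegree_X j).le)
      (by rw [aeval_X_left_apply, hc, linForm_single])
      (fun l hl ↦ by_contra fun h ↦ linForm_ne_zero h (by rwa [aeval_X_left_apply] at hl))
      (r := r) hs
    simpa only [aeval_X_left_apply] using this
  by_cases hT : linForm D.b ^ 2 - 4 * linForm D.a * linForm D.c = 0
  · by_cases h2 : (2 : k) = 0
    · -- in characteristic two the conic has the equation `A t² + C s² + G = 0`
      have h2' : (2 : MvPolynomial (Fin n) k) = 0 := by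
        rw [show (2 : MvPolynomial (Fin n) k) = C 2 from (map_ofNat C 2).symm, h2, map_zero]
      have hb : linForm D.b = 0 := by
        refine pow_eq_zero_iff two_ne_zero |>.mp ?_
        linear_combination hT + 2 * linForm D.a * linForm D.c * h2'
      have hq₁ : D.q₁ = 0 := by
        by_contra hne
        refine hquad D.q₀ D.q₁ hne ?_
        rw [disc, hb] at h0
        rw [hb]
        linear_combination -h0 + 2 * linForm D.a * linForm D.c * D.g * h2'
      have hq₀ : D.q₀ = 0 := by
        rw [disc, hb, hq₁] at h0
        have : linForm D.c * D.q₀ ^ 2 = 0 := by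
          linear_combination -h0 + 2 * linForm D.a * linForm D.c * D.g * h2'
        simpa [hC0] using this
      obtain ⟨Ω, _, _, w, hw, hw0⟩ := exists_ne_zero_of_card_lt (show n < n + 2 by omega)
        (fun j ↦ pderiv j.succ.succ D.poly) (fun j ↦
          aeval_zero_of_isHomogeneous D.isHomogeneous_poly.pderiv (by simp))
      have h2Ω : (2 : Ω) = 0 := by
        rw [show (2 : Ω) = algebraMap k Ω 2 from (map_ofNat (algebraMap k Ω) 2).symm, h2, map_zero]
      obtain ⟨s, t, y, rfl⟩ : ∃ s t y, w = Fin.cons s (Fin.cons t y) :=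
        ⟨w 0, w 1, fun j ↦ w j.succ.succ, funext <| Fin.cases rfl <| Fin.cases rfl fun j ↦ rfl⟩
      have hder : ∀ j, aeval (Fin.cons s (Fin.cons t y) : Fin (n + 2) → Ω)
          (pderiv j D.poly) = 0 := by
        refine Fin.cases ?_ <| Fin.cases ?_ hw0
        · rw [aeval_pderiv_zero, hb, hq₁, h2Ω]
          simp
        · rw [Fin.succ_zero_eq_one, aeval_pderiv_one, hb, hq₀, h2Ω]
          simp
      refine hw (hD Ω _ ?_ hder)
      -- Euler's identity expresses the cubic by its partial derivatives
      have := congrArg (aeval (Fin.cons s (Fin.cons t y) : Fin (n + 2) → Ω))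
        D.isHomogeneous_poly.sum_X_mul_pderiv
      simp only [map_sum, map_mul, hder, mul_zero, Finset.sum_const_zero, map_nsmul] at this
      rw [nsmul_eq_mul] at this
      push_cast at this
      linear_combination -this - h2Ω * aeval (Fin.cons s (Fin.cons t y) : Fin (n + 2) → Ω) D.poly
    · -- in other characteristics `-B / 2C` is a double root of `C x² + B x + A`
      refine hquad (-linForm D.b) (2 * linForm D.c) (mul_ne_zero ?_ hC0) ?_
      · rw [show (2 : MvPolynomial (Fin n) k) = C 2 from (map_ofNat C 2).symm]
        simpa using h2
      · linear_combination (-linForm D.c) * hT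
  · -- by Cramer's rule, `(s : t : T y)` is the singular point of the conic in the plane of `y`,
    -- and the derivatives in `y` of the cubic at this point are, up to the factor `-T` and multiples
    -- of the discriminant, those of the discriminant
    set T := linForm D.b ^ 2 - 4 * linForm D.a * linForm D.c with hTdef
    set s := 2 * linForm D.a * D.q₁ - linForm D.b * D.q₀ with hs
    set t := 2 * linForm D.c * D.q₀ - linForm D.b * D.q₁ with ht
    have hev : ∀ {p : MvPolynomial (Fin n) k} {d : ℕ}, p.IsHomogeneous d →
        aeval (fun j ↦ T * X j) p = T ^ d * p := fun {p d} hp ↦ by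
      rw [aeval_mul_of_isHomogeneous hp, aeval_X_left_apply]
    have hl : ∀ l : Fin n → k, aeval (fun j ↦ T * X j) (linForm l) = T ^ 1 * linForm l := fun l ↦
      hev (linForm_isHomogeneous l)
    have hw := hD.eq_zero (Fin.cons s (Fin.cons t fun j ↦ T * X j)) ?_ ?_
    · have := congrFun hw i.succ.succ
      simp [hT] at this
    · rw [aeval_poly]
      simp only [hl, hev D.hq₀, hev D.hq₁, hev D.hg]
      rw [disc] at h0
      rw [hs, ht, hTdef]
      linear_combination (-(linForm D.b ^ 2 - 4 * linForm D.a * linForm D.c) ^ 2) * h0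
    · refine Fin.cases ?_ <| Fin.cases ?_ fun j ↦ ?_
      · rw [aeval_pderiv_zero]
        simp only [hl, hev D.hq₁]
        rw [hs, ht, hTdef]
        ring
      · rw [Fin.succ_zero_eq_one, aeval_pderiv_one]
        simp only [hl, hev D.hq₀]
        rw [hs, ht, hTdef]
        ring
      · have hd := congrArg (pderiv j) h0
        have h4 : pderiv j (4 : MvPolynomial (Fin n) k) = 0 := by
          rw [show (4 : MvPolynomial (Fin n) k) = C 4 from (map_ofNat C 4).symm, pderiv_C]
        simp only [disc, map_sub, map_add, Derivation.leibniz, Derivation.leibniz_pow,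
            pderiv_linForm,
          map_zero, smul_eq_mul, nsmul_eq_mul, h4] at hd
        rw [aeval_pderiv_succ_succ, hev D.hq₁.pderiv, hev D.hq₀.pderiv, hev D.hg.pderiv]
        simp only [algebraMap_eq]
        rw [disc] at h0
        rw [hs, ht, hTdef]
        push_cast at hd
        linear_combination (-(linForm D.b ^ 2 - 4 * linForm D.a * linForm D.c)) * hd +
          (2 * linForm D.b * C (D.b j) - 4 * linForm D.a * C (D.c j) -
            4 * linForm D.c * C (D.a j)) * h0

end LineCubic

/-! ### Linear changes of coordinates -/

open Matrix

section LinSubst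

variable {k : Type u} [Field k] {N : ℕ}

/-- The substitution of the linear form with coefficients `M i` for the variable `Xᵢ`. -/
noncomputable def linSubst (M : Matrix (Fin N) (Fin N) k) :
    MvPolynomial (Fin N) k →ₐ[k] MvPolynomial (Fin N) k :=
  aeval fun i ↦ linForm (M i)

theorem linSubst_linForm (M : Matrix (Fin N) (Fin N) k) (r : Fin N → k) :
    linSubst M (linForm r) = linForm (r ᵥ* M) := by
  rw [linSubst, aeval_linForm]
  simp only [linForm, vecMul, dotProduct, map_sum, Finset.mul_sum, Finset.sum_mul, map_mul,
    algebraMap_eq]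
  rw [Finset.sum_comm]
  simp only [mul_assoc]

theorem linSubst_linSubst (M M' : Matrix (Fin N) (Fin N) k) (p : MvPolynomial (Fin N) k) :
    linSubst M (linSubst M' p) = linSubst (M' * M) p := by
  rw [← AlgHom.comp_apply]
  congr 1
  ext i : 1
  simp only [AlgHom.comp_apply]
  rw [linSubst.eq_def M', aeval_X, linSubst_linForm, linSubst.eq_def (M' * M), aeval_X]
  rfl

theorem linSubst_one (p : MvPolynomial (Fin N) k) : linSubst 1 p = p := by
  have : linSubst (1 : Matrix (Fin N) (Fin N) k) = AlgHom.id k _ := by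
    ext i : 1
    rw [linSubst, aeval_X, show (1 : Matrix (Fin N) (Fin N) k) i = Pi.single i 1 by
      ext j; simp [Matrix.one_apply, Pi.single_apply, eq_comm], LineCubic.linForm_single]
    rfl
  rw [this, AlgHom.id_apply]

theorem IsHomogeneous.linSubst {p : MvPolynomial (Fin N) k} {d : ℕ} (hp : p.IsHomogeneous d)
    (M : Matrix (Fin N) (Fin N) k) : (linSubst M p).IsHomogeneous d := by
  have := hp.aeval (fun i ↦ linForm (M i)) (fun i ↦ linForm_isHomogeneous _)
  rwa [one_mul] at this

theorem aeval_linSubst {B : Type*} [CommRing B] [Algebra k B] (M : Matrix (Fin N) (Fin N) k)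
    (w : Fin N → B) (p : MvPolynomial (Fin N) k) :
    aeval w (linSubst M p) = aeval (fun i ↦ aeval w (linForm (M i))) p := by
  rw [linSubst, ← AlgHom.comp_apply, comp_aeval]

theorem eq_aeval_linForm_of_mul_eq_one {B : Type*} [CommRing B] [Algebra k B]
    {M M' : Matrix (Fin N) (Fin N) k} (h : M' * M = 1) (w : Fin N → B) (i : Fin N) :
    aeval (fun i ↦ aeval w (linForm (M i))) (linForm (M' i)) = w i := by
  have h1 : linForm (M' i) = linSubst M' (X i) := by rw [linSubst, aeval_X]
  rw [h1, ← aeval_linSubst, linSubst_linSubst, h, linSubst_one, aeval_X]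

/-- The chain rule for polynomials. -/
theorem pderiv_aeval {σ τ : Type*} [Fintype σ] (g : σ → MvPolynomial τ k) (p : MvPolynomial σ k)
    (j : τ) : pderiv j (aeval g p) = ∑ i, aeval g (pderiv i p) * pderiv j (g i) := by
  induction p using MvPolynomial.induction_on with
  | C a => simp [algebraMap_eq]
  | add p q hp hq => simp only [map_add, hp, hq, add_mul, Finset.sum_add_distrib]
  | mul_X p i hp =>
    classical
    simp only [map_mul, aeval_X, Derivation.leibniz, hp, pderiv_X, smul_eq_mul, map_add, add_mul,
      Finset.sum_add_distrib, Finset.mul_sum]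
    congr 1
    · rw [Finset.sum_eq_single i]
      · simp
      · intro b _ hb
        simp [hb.symm]
      · simp
    · exact Finset.sum_congr rfl fun b _ ↦ by ring

theorem IsNonsingular.linSubst {F : MvPolynomial (Fin N) k} (hF : IsNonsingular F)
    {M M' : Matrix (Fin N) (Fin N) k} (h : M * M' = 1) :
    IsNonsingular (CubicUnirational.linSubst M F) := by
  intro Ω _ _ w h0 h1
  have h' : M' * M = 1 := mul_eq_one_comm.mp h
  have := hF Ω (fun i ↦ aeval w (linForm (M i))) (by rwa [aeval_linSubst] at h0) fun j ↦ by
    have h2 : F = CubicUnirational.linSubst M' (CubicUnirational.linSubst M F) := by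
      rw [linSubst_linSubst, h, linSubst_one]
    rw [h2]
    conv_lhs => rw [CubicUnirational.linSubst.eq_def M']
    rw [pderiv_aeval, map_sum]
    refine Finset.sum_eq_zero fun i _ ↦ ?_
    rw [map_mul, ← AlgHom.comp_apply, comp_aeval]
    simp only [eq_aeval_linForm_of_mul_eq_one h']
    rw [h1, zero_mul]
  funext i
  rw [← eq_aeval_linForm_of_mul_eq_one h' w i, this]
  exact LineCubic.aeval_zero_of_isHomogeneous (linForm_isHomogeneous _) one_ne_zero

/-- A linearly independent family of vectors can be completed to the rows of an invertible
matrix. -/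
theorem exists_matrix_of_linearIndependent {ι : Type*} (f : ι → Fin N) (hf : f.Injective)
    (l : ι → Fin N → k) (hl : LinearIndependent k l) :
    ∃ M M' : Matrix (Fin N) (Fin N) k, M * M' = 1 ∧ ∀ i, M (f i) = l i := by
  classical
  have : Finite ι := Finite.of_injective f hf
  have := Fintype.ofFinite ι
  let b := Module.Basis.sumExtend hl
  have : Finite (ι ⊕ Module.Basis.sumExtendIndex hl) := Module.Finite.finite_basis b
  have : Finite (Module.Basis.sumExtendIndex hl) :=
    Finite.of_injective (Sum.inr : _ → ι ⊕ Module.Basis.sumExtendIndex hl) Sum.inr_injective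
  have := Fintype.ofFinite (Module.Basis.sumExtendIndex hl)
  have hcard : Fintype.card (Module.Basis.sumExtendIndex hl) =
      Fintype.card {j // ¬ j ∈ Set.range f} := by
    have h1 := Module.finrank_eq_card_basis b
    rw [Module.finrank_fin_fun, Fintype.card_sum] at h1
    have h2 := Fintype.card_congr (Equiv.sumCompl (· ∈ Set.range f))
    rw [Fintype.card_sum, Fintype.card_fin] at h2
    have h3 := Fintype.card_congr (Equiv.ofInjective f hf)
    have h4 : Fintype.card {j // j ∈ Set.range f} = Fintype.card (Set.range f) := rfl
    omega
  let e : ι ⊕ Module.Basis.sumExtendIndex hl ≃ Fin N :=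
    (Equiv.sumCongr (Equiv.ofInjective f hf) (Fintype.equivOfCardEq hcard)).trans
      (Equiv.sumCompl (· ∈ Set.range f))
  let b' := b.reindex e
  have hb' : ∀ i, b' (f i) = l i := fun i ↦ by
    have : e.symm (f i) = Sum.inl i := by
      rw [Equiv.symm_apply_eq]
      simp [e]
    rw [Module.Basis.reindex_apply, this]
    simp only [b, Module.Basis.sumExtend, Module.Basis.reindex_apply,
        Module.Basis.extend_apply_self]
    rfl
  have h1 : (b'.toMatrix (Pi.basisFun k (Fin N)))ᵀ * ((Pi.basisFun k (Fin N)).toMatrix b')ᵀ = 1 := by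
    rw [← transpose_mul, Module.Basis.toMatrix_mul_toMatrix_flip, transpose_one]
  refine ⟨_, _, mul_eq_one_comm.mp h1, fun i ↦ ?_⟩
  ext j
  rw [← hb' i]
  simp [Module.Basis.toMatrix_apply]

/-- A point `v` of the hypersurface `F = 0` with coordinates in `K` at which only the multiples of
`F` vanish, among forms, and whose ratios of coordinates generate a subfield of index two: a
parametrization of degree two of the hypersurface by a variety with function field `K`. -/
def HasDoubleParam (F : MvPolynomial (Fin N) k) (K : Type u) [Field K] [Algebra k K] : Prop :=
  ∃ v : Fin N → K, v ≠ 0 ∧ aeval v F = 0 ∧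
    (∀ (d : ℕ) (G : MvPolynomial (Fin N) k), G.IsHomogeneous d → aeval v G = 0 → F ∣ G) ∧
    Module.finrank (IntermediateField.adjoin k {x | ∃ i j, x = v i / v j}) K = 2

theorem adjoin_ratio_le {K : Type*} [Field K] [Algebra k K] (M : Matrix (Fin N) (Fin N) k)
    {v : Fin N → K} (hv : v ≠ 0) :
    IntermediateField.adjoin k {x | ∃ i j, x = aeval v (linForm (M i)) / aeval v (linForm (M j))} ≤
      IntermediateField.adjoin k {x | ∃ i j, x = v i / v j} := by
  rw [IntermediateField.adjoin_le_iff]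
  rintro _ ⟨i, j, rfl⟩
  obtain ⟨a, ha⟩ := Function.ne_iff.mp hv
  have h : ∀ r : Fin N → k, aeval v (linForm r) / v a ∈
      IntermediateField.adjoin k {x | ∃ i j, x = v i / v j} := fun r ↦ by
    rw [aeval_linForm, Finset.sum_div]
    refine sum_mem fun i _ ↦ ?_
    rw [mul_div_assoc]
    exact mul_mem (algebraMap_mem _ _) (IntermediateField.subset_adjoin _ _ ⟨i, a, rfl⟩)
  rw [← div_div_div_cancel_right₀ ha]
  exact div_mem (h _) (h _)

theorem HasDoubleParam.of_linSubst {F : MvPolynomial (Fin N) k} {K : Type u} [Field K]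
    [Algebra k K] {M M' : Matrix (Fin N) (Fin N) k} (h : M * M' = 1)
    (H : HasDoubleParam (linSubst M F) K) : HasDoubleParam F K := by
  obtain ⟨v, hv, hF, hker, hrank⟩ := H
  have h' : M' * M = 1 := mul_eq_one_comm.mp h
  have hv' : (fun i ↦ aeval v (linForm (M i))) ≠ 0 := fun h0 ↦ hv <| funext fun i ↦ by
    rw [← eq_aeval_linForm_of_mul_eq_one h' v i, h0]
    exact LineCubic.aeval_zero_of_isHomogeneous (linForm_isHomogeneous _) one_ne_zero
  refine ⟨fun i ↦ aeval v (linForm (M i)), hv', by rwa [aeval_linSubst] at hF,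
    fun d G hG h0 ↦ ?_, ?_⟩
  · rw [← aeval_linSubst] at h0
    obtain ⟨H, hH⟩ := hker d _ (IsHomogeneous.linSubst hG M) h0
    refine ⟨linSubst M' H, ?_⟩
    have := congrArg (linSubst M') hH
    rwa [map_mul, linSubst_linSubst, linSubst_linSubst, h, linSubst_one, linSubst_one] at this
  · have hle := adjoin_ratio_le M' hv'
    simp only [eq_aeval_linForm_of_mul_eq_one h'] at hle
    rwa [le_antisymm (adjoin_ratio_le M hv) hle]

end LinSubst

/-! ### The normal form of a cubic through a line -/

/-- The expansion of a form in powers of the first variable. -/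
theorem IsHomogeneous.exists_expansion {k : Type*} [Field k] {N d : ℕ}
    {φ : MvPolynomial (Fin (N + 1)) k} (hφ : φ.IsHomogeneous d) :
    ∃ c : ℕ → MvPolynomial (Fin N) k, (∀ i j, i + j = d → (c i).IsHomogeneous j) ∧
      φ = ∑ i ∈ Finset.range (d + 1), X 0 ^ i * rename Fin.succ (c i) := by
  refine ⟨fun i ↦ (finSuccEquiv k N φ).coeff i, fun i j hij ↦
    hφ.finSuccEquiv_coeff_isHomogeneous i j hij, (finSuccEquiv k N).injective ?_⟩
  have hren : ∀ p, finSuccEquiv k N (rename Fin.succ p) = Polynomial.C p := fun p ↦ by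
    have : (finSuccEquiv k N : _ →ₐ[k] _).comp (rename Fin.succ) =
        (IsScalarTower.toAlgHom k (MvPolynomial (Fin N) k) (Polynomial (MvPolynomial (Fin N) k))) := by
      ext j : 1
      simp [finSuccEquiv_X_succ]
    exact congrArg (fun f ↦ f p) this
  conv_lhs => rw [Polynomial.as_sum_range' (finSuccEquiv k N φ) (d + 1) (by
    rw [natDegree_finSuccEquiv]
    exact Nat.lt_succ_of_le ((degreeOf_le_totalDegree _ _).trans hφ.totalDegree_le))]
  rw [map_sum]
  refine Finset.sum_congr rfl fun i _ ↦ ?_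
  rw [map_mul, map_pow, finSuccEquiv_X_zero, hren, ← Polynomial.C_mul_X_pow_eq_monomial, mul_comm]

theorem IsHomogeneous.exists_eq_linForm {k : Type*} [Field k] {n : ℕ} {p : MvPolynomial (Fin n) k}
    (hp : p.IsHomogeneous 1) : ∃ a : Fin n → k, p = linForm a := by
  rw [← mem_homogeneousSubmodule, homogeneousSubmodule_one_eq_span_X,
    Submodule.mem_span_range_iff_exists_fun] at hp
  obtain ⟨a, rfl⟩ := hp
  exact ⟨a, by simp [linForm, smul_eq_C_mul]⟩

/-- A cubic form which vanishes at the generic point `(1 : T : 0)` of the line `y = 0` has the shape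
of a `LineCubic`. -/
theorem LineCubic.exists_eq_poly {k : Type u} [Field k] {n : ℕ} {F : MvPolynomial (Fin (n + 2)) k}
    (hF : F.IsHomogeneous 3)
    (h0 : aeval (Fin.cons 1 (Fin.cons Polynomial.X 0) : Fin (n + 2) → Polynomial k) F = 0) :
    ∃ D : LineCubic k n, F = D.poly := by
  obtain ⟨c, hc, rfl⟩ := IsHomogeneous.exists_expansion hF
  obtain ⟨c₀, hc₀, h₀⟩ := IsHomogeneous.exists_expansion (hc 0 3 rfl)
  obtain ⟨c₁, hc₁, h₁⟩ := IsHomogeneous.exists_expansion (hc 1 2 rfl)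
  obtain ⟨c₂, hc₂, h₂⟩ := IsHomogeneous.exists_expansion (hc 2 1 rfl)
  obtain ⟨c₃, hc₃, h₃⟩ := IsHomogeneous.exists_expansion (hc 3 0 rfl)
  have hconst : ∀ p : MvPolynomial (Fin n) k, p.IsHomogeneous 0 → ∃ e : k, p = C e := fun p hp ↦
    ⟨_, totalDegree_eq_zero_iff_eq_C.mp (Nat.le_zero.mp hp.totalDegree_le)⟩
  obtain ⟨e₀, he₀⟩ := hconst _ (hc₀ 3 0 rfl)
  obtain ⟨e₁, he₁⟩ := hconst _ (hc₁ 2 0 rfl)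
  obtain ⟨e₂, he₂⟩ := hconst _ (hc₂ 1 0 rfl)
  obtain ⟨e₃, he₃⟩ := hconst _ (hc₃ 0 0 rfl)
  obtain ⟨a, ha⟩ := IsHomogeneous.exists_eq_linForm (hc₀ 2 1 rfl)
  obtain ⟨b, hb⟩ := IsHomogeneous.exists_eq_linForm (hc₁ 1 1 rfl)
  obtain ⟨l, hl⟩ := IsHomogeneous.exists_eq_linForm (hc₂ 0 1 rfl)
  simp only [Finset.sum_range_succ, Finset.sum_range_zero, zero_add, pow_zero, one_mul, pow_one,
    he₀, he₁, he₂, he₃, ha, hb, hl] at h₀ h₁ h₂ h₃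
  simp only [Finset.sum_range_succ, Finset.sum_range_zero, zero_add, pow_zero, one_mul, pow_one,
    h₀, h₁, h₂, h₃, map_add, map_mul, map_pow, rename_X, rename_rename, rename_C] at h0 ⊢
  have hz : ∀ p : MvPolynomial (Fin n) k, ∀ d, p.IsHomogeneous d → d ≠ 0 →
      aeval (Fin.cons 1 (Fin.cons Polynomial.X 0) : Fin (n + 2) → Polynomial k)
        (rename (Fin.succ ∘ Fin.succ) p) = 0 := fun p d hp hd ↦ by
    rw [show (Fin.succ ∘ Fin.succ : Fin n → Fin (n + 2)) = fun j ↦ j.succ.succ from rfl,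
      LineCubic.aeval_rename_succ_succ]
    exact LineCubic.aeval_zero_of_isHomogeneous hp hd
  have h1 : (Fin.cons 1 (Fin.cons Polynomial.X 0) : Fin (n + 2) → Polynomial k) 1 = Polynomial.X :=
    rfl
  simp only [hz _ _ (linForm_isHomogeneous _) one_ne_zero, hz _ _ (hc₀ 0 3 rfl) three_ne_zero,
    hz _ _ (hc₀ 1 2 rfl) two_ne_zero, hz _ _ (hc₁ 0 2 rfl) two_ne_zero, aeval_X, Fin.cons_zero,
    algHom_C, Fin.succ_zero_eq_one, h1, mul_zero, zero_add, add_zero, one_pow, one_mul] at h0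
  have hcoeff := fun i ↦ congrArg (Polynomial.coeff · i) h0
  have hE₀ := hcoeff 3
  have hE₁ := hcoeff 2
  have hE₂ := hcoeff 1
  have hE₃ := hcoeff 0
  simp [Polynomial.coeff_X, Polynomial.coeff_C, Polynomial.coeff_X_pow] at hE₀ hE₁ hE₂ hE₃
  refine ⟨⟨a, b, l, c₀ 1, c₁ 0, c₀ 0, hc₀ 1 2 rfl, hc₁ 0 2 rfl, hc₀ 0 3 rfl⟩, ?_⟩
  simp only [LineCubic.poly, hE₀, hE₁, hE₂, hE₃, map_zero, Fin.succ_zero_eq_one]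
  simp only [show (Fin.succ ∘ Fin.succ : Fin n → Fin (n + 2)) = fun j ↦ j.succ.succ from rfl]
  ring

/-! ### Normalization of the leading linear form -/

namespace LineCubic

variable {k : Type u} [Field k] {n : ℕ} (D : LineCubic k n)

open Matrix

/-- The cubic obtained by a linear change of the variables `y`. -/
noncomputable def substY (P : Matrix (Fin n) (Fin n) k) : LineCubic k n where
  a := D.a ᵥ* P
  b := D.b ᵥ* P
  c := D.c ᵥ* P
  q₀ := linSubst P D.q₀
  q₁ := linSubst P D.q₁
  g := linSubst P D.g
  hq₀ := IsHomogeneous.linSubst D.hq₀ P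
  hq₁ := IsHomogeneous.linSubst D.hq₁ P
  hg := IsHomogeneous.linSubst D.hg P

/-- The matrix of a linear change of the variables `y` which fixes `s` and `t`. -/
def extendMatrix (P : Matrix (Fin n) (Fin n) k) : Matrix (Fin (n + 2)) (Fin (n + 2)) k :=
  Fin.cons (Pi.single 0 1) (Fin.cons (Pi.single 1 1) fun j ↦ Fin.cons 0 (Fin.cons 0 (P j)))

theorem linForm_extendMatrix (P : Matrix (Fin n) (Fin n) k) :
    (fun i ↦ linForm (extendMatrix P i)) = (Fin.cons (X 0) (Fin.cons (X 1) fun j ↦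
      rename (fun j ↦ j.succ.succ) (linForm (P j))) :
        Fin (n + 2) → MvPolynomial (Fin (n + 2)) k) := by
  funext i
  refine Fin.cases (linForm_single 0) (Fin.cases (linForm_single 1) fun j ↦ ?_) i
  simp [extendMatrix, linForm, Fin.sum_univ_succ]

theorem linSubst_extendMatrix_rename (P : Matrix (Fin n) (Fin n) k) (p : MvPolynomial (Fin n) k) :
    linSubst (extendMatrix P) (rename (fun j ↦ j.succ.succ) p) =
      rename (fun j ↦ j.succ.succ) (linSubst P p) := by
  rw [linSubst, linForm_extendMatrix, aeval_rename_succ_succ, linSubst, ← AlgHom.comp_apply,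
    comp_aeval]

theorem linForm_injective :
    Function.Injective (linForm : (Fin n → k) → MvPolynomial (Fin n) k) := by
  intro a b h
  funext j
  have := congrArg (pderiv j) (show linForm a = linForm b from h)
  simpa [pderiv_linForm] using this

theorem extendMatrix_mul_eq_one {P P' : Matrix (Fin n) (Fin n) k} (h : P * P' = 1) :
    extendMatrix P * extendMatrix P' = 1 := by
  refine funext fun i ↦ ?_
  refine linForm_injective (k := k) ?_
  rw [mul_apply_eq_vecMul, ← linSubst_linForm, congrFun (linForm_extendMatrix P) i,
    show (1 : Matrix (Fin (n + 2)) (Fin (n + 2)) k) i = Pi.single i 1 by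
      ext j; simp [Matrix.one_apply, Pi.single_apply, eq_comm], linForm_single]
  refine Fin.cases ?_ (Fin.cases ?_ fun j ↦ ?_) i
  · rw [Fin.cons_zero, linSubst, aeval_X, congrFun (linForm_extendMatrix P') 0, Fin.cons_zero]
  · rw [Fin.cons_succ, Fin.cons_zero, linSubst, aeval_X, Fin.succ_zero_eq_one,
      congrFun (linForm_extendMatrix P') 1]
    rfl
  · have h1 : linForm (P j) = linSubst P (X j) := by rw [linSubst, aeval_X]
    rw [Fin.cons_succ, Fin.cons_succ, linSubst_extendMatrix_rename, h1, linSubst_linSubst, h,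
      linSubst_one, rename_X]

theorem linSubst_extendMatrix_poly (P : Matrix (Fin n) (Fin n) k) :
    linSubst (extendMatrix P) D.poly = (D.substY P).poly := by
  have h0 : linSubst (extendMatrix P) (X 0) = X 0 := by
    rw [linSubst, aeval_X, congrFun (linForm_extendMatrix P) 0, Fin.cons_zero]
  have h1 : linSubst (extendMatrix P) (X 1) = X 1 := by
    rw [linSubst, aeval_X, congrFun (linForm_extendMatrix P) 1]
    rfl
  simp only [poly, map_add, map_mul, map_pow, linSubst_extendMatrix_rename, h0, h1, substY,
    linSubst_linForm]

/-- After a linear change of the variables `y`, the linear form `C` is a variable. -/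
theorem exists_substY_c_eq (hc : D.c ≠ 0) (i : Fin n) :
    ∃ P P' : Matrix (Fin n) (Fin n) k, P * P' = 1 ∧ (D.substY P).c = Pi.single i 1 := by
  obtain ⟨Q, Q', hQ, hi⟩ := exists_matrix_of_linearIndependent (fun _ : Unit ↦ i)
    (fun _ _ _ ↦ rfl) (fun _ ↦ D.c) (LinearIndependent.of_subsingleton () hc)
  refine ⟨Q', Q, mul_eq_one_comm.mp hQ, ?_⟩
  rw [substY, ← hi (), ← mul_apply_eq_vecMul, hQ]
  ext j
  simp [Matrix.one_apply, Pi.single_apply, eq_comm]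

/-! ### Forms vanishing at a point of the cubic -/

attribute [local instance] MvPolynomial.gradedAlgebra in
theorem homogeneousComponent_mul_left {σ R : Type*} [CommRing R] {p : MvPolynomial σ R} {i : ℕ}
    (hp : p.IsHomogeneous i) (q : MvPolynomial σ R) (j : ℕ) :
    homogeneousComponent (i + j) (p * q) = p * homogeneousComponent j q := by
  have := DirectSum.coe_decompose_mul_add_of_left_mem (homogeneousSubmodule σ R)
    (i := i) (j := j) (b := q) (mem_homogeneousSubmodule i p |>.mpr hp)
  rw [← decomposition.decompose'_apply, ← decomposition.decompose'_apply]
  exact this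

/-- Division of a polynomial by the cubic with respect to the variable `s`, up to powers of the
leading coefficient. -/
theorem exists_pow_mul_eq {i : Fin n} (hc : D.c = Pi.single i 1)
    (G : MvPolynomial (Fin (n + 2)) k) : ∃ (e : ℕ) (H : MvPolynomial (Fin (n + 2)) k)
      (a b : MvPolynomial (Fin (n + 1)) k),
      X i.succ.succ ^ e * G = D.poly * H + X 0 * rename Fin.succ a + rename Fin.succ b := by
  have hC : rename (fun j ↦ (j.succ.succ : Fin (n + 2))) (linForm D.c) = X i.succ.succ := by
    rw [hc, linForm_single, rename_X]
  have hi : (X i.succ.succ : MvPolynomial (Fin (n + 2)) k) = rename Fin.succ (X i.succ) := by simp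
  induction G using MvPolynomial.induction_on with
  | C x => exact ⟨0, 0, 0, C x, by simp⟩
  | add p q hp hq =>
    obtain ⟨e₁, H₁, a₁, b₁, h₁⟩ := hp
    obtain ⟨e₂, H₂, a₂, b₂, h₂⟩ := hq
    refine ⟨e₁ + e₂, X i.succ.succ ^ e₂ * H₁ + X i.succ.succ ^ e₁ * H₂,
      X i.succ ^ e₂ * a₁ + X i.succ ^ e₁ * a₂, X i.succ ^ e₂ * b₁ + X i.succ ^ e₁ * b₂, ?_⟩
    simp only [map_add, map_mul, map_pow, rename_X]
    linear_combination X i.succ.succ ^ e₂ * h₁ + X i.succ.succ ^ e₁ * h₂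
  | mul_X p j hp =>
    obtain ⟨e, H, a, b, h⟩ := hp
    refine Fin.cases ?_ (fun j ↦ ?_) j
    · -- here `C s² = F - s (t B + Q₁) - (t² A + t Q₀ + G)` is used
      refine ⟨e + 1, X i.succ.succ * X 0 * H + rename Fin.succ a,
        X i.succ * b - a * (X 0 * rename Fin.succ (linForm D.b) + rename Fin.succ D.q₁),
        -(a * (X 0 ^ 2 * rename Fin.succ (linForm D.a) + X 0 * rename Fin.succ D.q₀ +
          rename Fin.succ D.g)), ?_⟩
      have hF : D.poly = X 0 ^ 2 * X i.succ.succ +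
        X 0 * X 1 * rename (fun j ↦ j.succ.succ) (linForm D.b) +
        X 1 ^ 2 * rename (fun j ↦ j.succ.succ) (linForm D.a) +
        X 0 * rename (fun j ↦ j.succ.succ) D.q₁ + X 1 * rename (fun j ↦ j.succ.succ) D.q₀ +
        rename (fun j ↦ j.succ.succ) D.g := by rw [← hC, poly]
      have hcomp : (Fin.succ ∘ Fin.succ : Fin n → Fin (n + 2)) = fun j ↦ j.succ.succ := rfl
      simp only [map_sub, map_add, map_mul, map_neg, map_pow, rename_X, rename_rename, hcomp,
        Fin.succ_zero_eq_one]
      linear_combination X i.succ.succ * X 0 * h - rename Fin.succ a * hF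
    · refine ⟨e, H * X j.succ, a * X j, b * X j, ?_⟩
      simp only [map_mul, rename_X]
      linear_combination X j.succ * h

/-- The cubic does not contain the hyperplane `C = 0`, since it is nonsingular along the line. -/
theorem not_X_dvd_poly (hD : IsNonsingular D.poly) {i : Fin n} (hc : D.c = Pi.single i 1) :
    ¬ X i.succ.succ ∣ D.poly := by
  rintro ⟨H, hH⟩
  obtain ⟨x, hx⟩ := IsAlgClosed.exists_root
    (Polynomial.X ^ 2 + Polynomial.C (algebraMap k (AlgebraicClosure k) (D.b i)) * Polynomial.X +
      Polynomial.C (algebraMap k (AlgebraicClosure k) (D.a i))) (by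
      rw [show Polynomial.degree _ = 2 by compute_degree!]; simp)
  obtain ⟨j, hj⟩ := D.exists_ne_zero hD (Ω := AlgebraicClosure k) (s := x) (t := 1) (by simp)
  by_cases hji : j = i
  · subst hji
    refine hj ?_
    simp [Polynomial.IsRoot] at hx
    simp [hc]
    linear_combination hx
  · have h1 := D.aeval_pderiv_succ_succ x 1 (0 : Fin n → AlgebraicClosure k) j
    rw [aeval_zero_of_isHomogeneous D.hq₁.pderiv (by simp),
      aeval_zero_of_isHomogeneous D.hq₀.pderiv (by simp),
      aeval_zero_of_isHomogeneous D.hg.pderiv (by simp), hH, Derivation.leibniz, pderiv_X_of_ne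
      (by simpa using Ne.symm hji)] at h1
    refine hj ?_
    simpa using h1.symm

/-- If the coordinates other than `s` of a point of the cubic are as independent as possible and
`s` is not rational in them, then every form vanishing at the point is a multiple of the cubic. -/
theorem poly_dvd_of_aeval_eq_zero (hD : IsNonsingular D.poly) {i : Fin n}
    (hc : D.c = Pi.single i 1) {K : Type*} [Field K] [Algebra k K] (L : IntermediateField k K)
    {s : K} (hs : s ∉ L) {w : Fin (n + 1) → K} (hw : ∀ j, w j ∈ L)
    (hdep : ∀ (d : ℕ) (p : MvPolynomial (Fin (n + 1)) k), p.IsHomogeneous d → aeval w p = 0 → p = 0)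
    (hF : aeval (Fin.cons s w : Fin (n + 2) → K) D.poly = 0)
    {d : ℕ} {G : MvPolynomial (Fin (n + 2)) k} (hG : G.IsHomogeneous d)
    (h0 : aeval (Fin.cons s w : Fin (n + 2) → K) G = 0) : D.poly ∣ G := by
  obtain ⟨e, H, a, b, h⟩ := D.exists_pow_mul_eq hc G
  -- the components of degree `e + d + 3` of the two sides
  have hX : (X i.succ.succ ^ 3 * (X i.succ.succ ^ e * G)).IsHomogeneous (3 + (e + d)) := by
    have := (isHomogeneous_X_pow (R := k) i.succ.succ 3).mul
      ((isHomogeneous_X_pow (R := k) i.succ.succ e).mul hG)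
    simpa using this
  have h1 := congrArg (homogeneousComponent (3 + (e + d)))
    (congrArg (fun p ↦ X i.succ.succ ^ 3 * p) h)
  obtain ⟨a', ha', hae⟩ : ∃ a' : MvPolynomial (Fin (n + 1)) k, a'.IsHomogeneous (2 + (e + d)) ∧
      homogeneousComponent (3 + (e + d)) (X i.succ.succ ^ 3 * (X 0 * rename Fin.succ a)) =
        X 0 * rename Fin.succ a' := by
    refine ⟨homogeneousComponent (2 + (e + d)) (X i.succ ^ 3 * a),
      homogeneousComponent_isHomogeneous _ _, ?_⟩
    rw [rename_homogeneousComponent, map_mul (rename _), map_pow (rename _), rename_X,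
      ← homogeneousComponent_mul_left (isHomogeneous_X k 0)]
    congr 1
    · ring_nf
    · ring
  obtain ⟨b', hb', hbe⟩ : ∃ b' : MvPolynomial (Fin (n + 1)) k, b'.IsHomogeneous (3 + (e + d)) ∧
      homogeneousComponent (3 + (e + d)) (X i.succ.succ ^ 3 * rename Fin.succ b) =
        rename Fin.succ b' := by
    refine ⟨homogeneousComponent (3 + (e + d)) (X i.succ ^ 3 * b),
      homogeneousComponent_isHomogeneous _ _, ?_⟩
    rw [rename_homogeneousComponent, map_mul (rename _), map_pow (rename _), rename_X]
  rw [homogeneousComponent_eq_self hX, mul_add, mul_add, map_add, map_add, hae, hbe,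
    mul_left_comm (X i.succ.succ ^ 3) D.poly, homogeneousComponent_mul_left D.isHomogeneous_poly]
      at h1
  -- both remainders vanish, since `s` is not rational in the other coordinates
  have h2 := congrArg (aeval (Fin.cons s w : Fin (n + 2) → K)) h1
  have hw' : (Fin.cons s w : Fin (n + 2) → K) ∘ Fin.succ = w := rfl
  simp only [map_mul, map_add, map_pow, h0, hF, aeval_rename, hw', aeval_X, Fin.cons_zero,
    mul_zero, zero_mul, zero_add] at h2
  have hmem := aeval_mem_of_forall_mem (k := k) hw
  have ha0 : aeval w a' = 0 := by
    by_contra hne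
    refine hs ?_
    rw [show s = -aeval w b' / aeval w a' by field_simp; linear_combination -h2]
    exact div_mem (neg_mem (hmem b')) (hmem a')
  have hb0 : aeval w b' = 0 := by rw [ha0] at h2; linear_combination -h2
  rw [hdep _ _ ha' ha0, hdep _ _ hb' hb0, map_zero, mul_zero, add_zero, add_zero, ← mul_assoc,
    ← pow_add] at h1
  -- `X i` is prime and does not divide the cubic
  have hrel : IsRelPrime D.poly (X i.succ.succ ^ (3 + e)) := by
    refine IsRelPrime.pow_right (IsRelPrime.symm ?_)
    exact (X_prime : Prime
      (X i.succ.succ : MvPolynomial (Fin (n + 2)) k)).irreducible.isRelPrime_iff_not_dvd.mpr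
        (D.not_X_dvd_poly hD hc)
  exact hrel.dvd_of_dvd_mul_left ⟨_, h1⟩

end LineCubic

/-! ### The double parametrization -/

section

variable {k K σ : Type*} [Field k] [Field K] [Algebra k K]

theorem isAlgebraic_of_mem {L : IntermediateField k K} {x : K} (hx : x ∈ L) : IsAlgebraic L x :=
  isAlgebraic_algebraMap (⟨x, hx⟩ : L)

open scoped IntermediateField.algebraAdjoinAdjoin in
theorem transcendental_adjoin_image_compl {x : σ → K} (hx : AlgebraicIndependent k x) (i : σ) :
    Transcendental (IntermediateField.adjoin k (x '' {i}ᶜ)) (x i) := by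
  have h := hx.transcendental_adjoin (s := {i}ᶜ) (i := i) (by simp)
  intro h0
  exact h ((IsFractionRing.isAlgebraic_iff _ (IntermediateField.adjoin k (x '' {i}ᶜ)) _).mpr h0)

end

namespace LineCubic

variable {k : Type u} [Field k] {N : ℕ} (D : LineCubic k (N + 2))

/-- The plane through the line and the point `(y₀ : 1 : y')` meets the residual conic in the point
`(u : 1)` of the line for a unique `y₀`, which is not `0`. -/
theorem exists_residual (hD : IsNonsingular D.poly) (hc : D.c = Pi.single 0 1) {K : Type*} [Field K]
    [Algebra k K] {z : Fin (N + 2) → K} (hz : AlgebraicIndependent k z) :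
    ∃ y : Fin (N + 2) → K, y 0 ≠ 0 ∧ y 1 = 1 ∧ (∀ j : Fin N, y j.succ.succ = z j.succ.succ) ∧
      y 0 ∈ IntermediateField.adjoin k (z '' {1}ᶜ) ∧
      aeval y (linForm D.c) * z 0 ^ 2 + aeval y (linForm D.b) * z 0 + aeval y (linForm D.a) = 0 := by
  let W : Fin (N + 1) → MvPolynomial (Fin (N + 2)) k := Fin.cons 1 fun j ↦ X j.succ.succ
  let P : MvPolynomial (Fin (N + 2)) k :=
    ∑ j : Fin (N + 1), (C (D.b j.succ) * X 0 + C (D.a j.succ)) * W j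
  let Q : MvPolynomial (Fin (N + 2)) k := X 0 ^ 2 + C (D.b 0) * X 0 + C (D.a 0)
  obtain ⟨x, hx⟩ := IsAlgClosed.exists_root
    (Polynomial.X ^ 2 + Polynomial.C (algebraMap k (AlgebraicClosure k) (D.b 0)) * Polynomial.X +
      Polynomial.C (algebraMap k (AlgebraicClosure k) (D.a 0))) (by
      rw [show Polynomial.degree _ = 2 by compute_degree!]; simp)
  -- if the polynomial `P` vanished, the three linear forms would have a common root `u = x`
  have hP : P ≠ 0 := by
    intro h0
    obtain ⟨j, hj⟩ := D.exists_ne_zero hD (Ω := AlgebraicClosure k) (s := x) (t := 1) (by simp)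
    have hev : ∀ w : Fin N → AlgebraicClosure k,
        algebraMap k (AlgebraicClosure k) (D.b 1) * x + algebraMap k (AlgebraicClosure k) (D.a 1) +
        ∑ j : Fin N, (algebraMap k (AlgebraicClosure k) (D.b j.succ.succ) * x +
          algebraMap k (AlgebraicClosure k) (D.a j.succ.succ)) * w j = 0 := fun w ↦ by
      have := congrArg (aeval (Fin.cons x (Fin.cons 0 w) : Fin (N + 2) → AlgebraicClosure k)) h0
      simpa [P, W, Fin.sum_univ_succ] using this
    have h1 := hev 0
    simp only [Pi.zero_apply, mul_zero, Finset.sum_const_zero, add_zero] at h1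
    refine hj ?_
    rw [hc]
    refine Fin.cases ?_ (Fin.cases ?_ fun j ↦ ?_) j
    · simp [Polynomial.IsRoot] at hx
      simp
      linear_combination hx
    · have : (Pi.single 0 1 : Fin (N + 2) → k) (Fin.succ 0) = 0 := by simp
      rw [this, map_zero, Fin.succ_zero_eq_one]
      linear_combination h1
    · have h2 := hev (Pi.single j 1)
      rw [h1, Finset.sum_eq_single j (fun i _ hi ↦ by simp [hi]) (by simp), Pi.single_eq_same] at h2
      have : (Pi.single 0 1 : Fin (N + 2) → k) j.succ.succ = 0 := by simp
      rw [this, map_zero]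
      linear_combination h2
  have hQ : Q ≠ 0 := by
    intro h0
    have h1 := congrArg (aeval (fun _ ↦ Polynomial.X : Fin (N + 2) → Polynomial k)) h0
    have h2 : (Polynomial.X ^ 2 + Polynomial.C (D.b 0) * Polynomial.X + Polynomial.C (D.a 0) :
        Polynomial k) = 0 := by
      simpa [Q] using h1
    simpa using congrArg (fun p ↦ Polynomial.coeff p 2) h2
  have hP' : aeval z P ≠ 0 := fun h ↦ hP (hz (h.trans (map_zero _).symm))
  have hQ' : aeval z Q ≠ 0 := fun h ↦ hQ (hz (h.trans (map_zero _).symm))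
  have hmem : ∀ j, j ≠ 1 → z j ∈ IntermediateField.adjoin k (z '' {1}ᶜ) := fun j hj ↦
    IntermediateField.subset_adjoin _ _ ⟨j, by simpa using hj, rfl⟩
  have hPe : aeval z P = ∑ j : Fin (N + 1), (algebraMap k K (D.b j.succ) * z 0 +
      algebraMap k K (D.a j.succ)) * (Fin.cons 1 fun j ↦ z j.succ.succ : Fin (N + 1) → K) j := by
    simp only [P, map_sum, map_mul, map_add, aeval_C, aeval_X]
    refine Finset.sum_congr rfl fun j _ ↦ ?_
    refine Fin.cases ?_ (fun j ↦ ?_) j <;> simp [W]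
  have hQe : aeval z Q = z 0 ^ 2 + algebraMap k K (D.b 0) * z 0 + algebraMap k K (D.a 0) := by
    simp [Q]
  refine ⟨Fin.cons (-aeval z P / aeval z Q) (Fin.cons 1 fun j ↦ z j.succ.succ), ?_,
    rfl, fun j ↦ rfl,
    ?_, ?_⟩
  · simpa using ⟨hP', hQ'⟩
  · rw [Fin.cons_zero]
    refine div_mem (neg_mem ?_) ?_
    · rw [hPe]
      refine sum_mem fun j _ ↦ mul_mem (add_mem (mul_mem (algebraMap_mem _ _) (hmem 0 (by simp)))
        (algebraMap_mem _ _)) ?_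
      refine Fin.cases (one_mem _) (fun j ↦ hmem _ ?_) j
      rw [← Fin.succ_zero_eq_one]
      exact fun h ↦ Fin.succ_ne_zero j (Fin.succ_injective _ h)
    · rw [hQe]
      exact add_mem (add_mem (pow_mem (hmem 0 (by simp)) 2)
        (mul_mem (algebraMap_mem _ _) (hmem 0 (by simp)))) (algebraMap_mem _ _)
  · have hdiv : -aeval z P / aeval z Q * aeval z Q = -aeval z P := by field_simp
    have hs : ∀ l : Fin (N + 2) → k,
        aeval (Fin.cons (-aeval z P / aeval z Q) (Fin.cons 1 fun j ↦ z j.succ.succ) :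
          Fin (N + 2) → K) (linForm l) = algebraMap k K (l 0) * (-aeval z P / aeval z Q) +
          ∑ j : Fin (N + 1), algebraMap k K (l j.succ) *
            (Fin.cons 1 fun j ↦ z j.succ.succ : Fin (N + 1) → K) j := fun l ↦ by
      rw [aeval_linForm, Fin.sum_univ_succ]
      rfl
    have hPs : aeval z P = (∑ j : Fin (N + 1), algebraMap k K (D.b j.succ) *
          (Fin.cons 1 fun j ↦ z j.succ.succ : Fin (N + 1) → K) j) * z 0 +
        ∑ j : Fin (N + 1), algebraMap k K (D.a j.succ) *
          (Fin.cons 1 fun j ↦ z j.succ.succ : Fin (N + 1) → K) j := by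
      rw [hPe, Finset.sum_mul, ← Finset.sum_add_distrib]
      exact Finset.sum_congr rfl fun j _ ↦ by ring
    have hcs : aeval (Fin.cons (-aeval z P / aeval z Q) (Fin.cons 1 fun j ↦ z j.succ.succ) :
          Fin (N + 2) → K) (linForm D.c) = -aeval z P / aeval z Q := by
      rw [hc, linForm_single, aeval_X, Fin.cons_zero]
    rw [hcs, hs, hs]
    linear_combination hdiv - (-aeval z P / aeval z Q) * hQe - hPs

end LineCubic

section

variable {k K : Type*} [Field k] [Field K] [Algebra k K]

open IntermediateField

theorem mem_adjoin_simple_of_mem {E : IntermediateField k K} (x : K) {y : K} (hy : y ∈ E) :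
    y ∈ E⟮x⟯ :=
  IntermediateField.algebraMap_mem E⟮x⟯ ⟨y, hy⟩

theorem adjoin_simple_le {E E' : IntermediateField k K} {S : Set K} {x y : K}
    (hE : E = adjoin k S) (hS : ∀ w ∈ S, w ∈ E'⟮y⟯) (hx : x ∈ E'⟮y⟯) {w : K} (hw : w ∈ E⟮x⟯) :
    w ∈ E'⟮y⟯ := by
  have hle : restrictScalars k E⟮x⟯ ≤ restrictScalars k E'⟮y⟯ := by
    rw [restrictScalars_adjoin, adjoin_le_iff, Set.union_subset_iff]
    constructor
    · change E ≤ _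
      rw [hE, adjoin_le_iff]
      exact hS
    · rintro _ rfl
      exact hx
  exact hle hw

end

namespace LineCubic

variable {k : Type u} [Field k] {N : ℕ} (D : LineCubic k (N + 2))

theorem aeval_disc {B : Type*} [CommRing B] [Algebra k B] (y : Fin (N + 2) → B) :
    aeval y D.disc = 4 * aeval y (linForm D.a) * aeval y (linForm D.c) * aeval y D.g +
      aeval y (linForm D.b) * aeval y D.q₀ * aeval y D.q₁ -
        aeval y (linForm D.a) * aeval y D.q₁ ^ 2 -
      aeval y (linForm D.c) * aeval y D.q₀ ^ 2 - aeval y D.g * aeval y (linForm D.b) ^ 2 := by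
  simp [disc]

/-- If the line joining the points `(u : 1 : 0)` and `(m : 0 : y)` of the plane through `y` meets
the residual conic twice in the first point, and this for general `m`, then the conic is
singular. -/
theorem residual_denominator_ne_zero {K : Type*} [Field K] [Algebra k K] {u m : K}
    {y : Fin (N + 2) → K} (E : IntermediateField k K) (hu : u ∈ E) (hy : ∀ j, y j ∈ E)
    (hm : Transcendental E m) (hdisc : aeval y D.disc ≠ 0)
    (h : aeval y (linForm D.c) * u ^ 2 + aeval y (linForm D.b) * u + aeval y (linForm D.a) = 0) :
    m * (aeval y (linForm D.b) + 2 * u * aeval y (linForm D.c)) +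
      (aeval y D.q₀ + u * aeval y D.q₁) ≠ 0 := by
  have hE := aeval_mem_of_forall_mem hy
  intro h0
  have h1 : (aeval y (linForm D.b) + 2 * u * aeval y (linForm D.c)) = 0 := by
    by_contra hne
    refine hm ?_
    have : m ∈ E := by
      rw [show m = -(aeval y D.q₀ + u * aeval y D.q₁) /
        (aeval y (linForm D.b) + 2 * u * aeval y (linForm D.c)) by
          rw [eq_div_iff hne]; linear_combination h0]
      exact div_mem (neg_mem (add_mem (hE _) (mul_mem hu (hE _))))
        (add_mem (hE _) (mul_mem (mul_mem (ofNat_mem E 2) hu) (hE _)))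
    exact isAlgebraic_of_mem this
  rw [h1, mul_zero, zero_add] at h0
  refine hdisc ?_
  rw [aeval_disc, show aeval y (linForm D.b) = -(2 * u * aeval y (linForm D.c)) by
    linear_combination h1, show aeval y D.q₀ = -(u * aeval y D.q₁) by linear_combination h0,
    show aeval y (linForm D.a) = u ^ 2 * aeval y (linForm D.c) by linear_combination h - u * h1]
  ring

/-- The parameter `u` is not rational over the field of rational functions in the plane and `t`. -/
theorem notMem_adjoin_of_residual (hD : IsNonsingular D.poly) (hc : D.c = Pi.single 0 1)
    {K : Type*} [Field K] [Algebra k K] {u : K} {τ y : Fin (N + 2) → K}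
    (hτ : AlgebraicIndependent k τ) (hy1 : y 1 = 1) (hyτ : ∀ j, j ≠ 1 → y j = τ j)
    (hdep : ∀ l : Fin (N + 2) → k, aeval y (linForm l) = 0 → l = 0)
    (h : aeval y (linForm D.c) * u ^ 2 + aeval y (linForm D.b) * u + aeval y (linForm D.a) = 0) :
    u ∉ IntermediateField.adjoin k (Set.range τ) := by
  intro hu
  obtain ⟨r, s, rfl⟩ := (IntermediateField.mem_adjoin_range_iff k τ u).mp hu
  let W : Fin (N + 2) → MvPolynomial (Fin (N + 2)) k := Function.update X 1 1
  have hW : ∀ p, aeval τ (aeval W p) = aeval y p := fun p ↦ by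
    rw [← AlgHom.comp_apply, comp_aeval]
    congr 2
    funext j
    by_cases hj : j = 1
    · simp [W, hj, hy1]
    · simp [W, hj, hyτ]
  have hs : s ≠ 0 := by
    rintro rfl
    have ha : aeval y (linForm D.a) = 0 := by simpa using h
    obtain ⟨j, hj⟩ := D.exists_ne_zero hD (Ω := k) (s := 0) (t := 1) (by simp)
    exact hj (by simp [hdep _ ha])
  have hs' : aeval τ s ≠ 0 := fun h ↦ hs (hτ (h.trans (map_zero _).symm))
  refine D.quadratic_ne_zero hD (W := W) (i := 0) (fun j ↦ ?_) ?_ (fun l hl ↦ hdep l ?_) hs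
    (r := r) (hτ ?_)
  · by_cases hj : j = 1
    · simp [W, hj]
    · simp [W, hj]
  · rw [hc, linForm_single, aeval_X]
    simp [W]
  · rw [← hW, hl, map_zero]
  · simp only [map_add, map_mul, map_pow, hW, map_zero]
    field_simp at h
    linear_combination h

/-- The family `z` with its first two members replaced. -/
def frame {α : Type*} (z : Fin (N + 2) → α) (x x' : α) : Fin (N + 2) → α :=
  Fin.cons x (Fin.cons x' fun j ↦ z j.succ.succ)

/-- The coordinates `t, y₀, y₂, …` of the generic point, that is, all but `y₁ = 1`, are distinct
members of the family `y₀, t, y₂, …`. -/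
theorem cons_injective_ne_two : Function.Injective fun j : {j : Fin (N + 3) // j ≠ 2} ↦
    (Fin.cons 1 (Fin.cons 0 (Fin.cons 0 fun j ↦ j.succ.succ)) : Fin (N + 3) → Fin (N + 2)) j.1 := by
  have h : ∀ j : Fin (N + 3), j.1 ≠ 2 → ((Fin.cons 1 (Fin.cons 0 (Fin.cons 0 fun j ↦ j.succ.succ)) :
      Fin (N + 3) → Fin (N + 2)) j).1 = if j.1 = 0 then 1 else if j.1 = 1 then 0 else j.1 - 1 :=
    Fin.cases (fun _ ↦ rfl) (Fin.cases (fun _ ↦ rfl) (Fin.cases (fun h ↦ (h rfl).elim)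
      fun j _ ↦ by simp))
  rintro ⟨i, hi⟩ ⟨j, hj⟩ hij
  have hi' : i.1 ≠ 2 := fun h ↦ hi (Fin.ext h)
  have hj' : j.1 ≠ 2 := fun h ↦ hj (Fin.ext h)
  have := congrArg Fin.val hij
  rw [h i hi', h j hj'] at this
  refine Subtype.ext (Fin.ext (show i.1 = j.1 from ?_))
  split_ifs at this <;> omega

/-- A nonsingular residual conic contains no line: the coordinate `s` of its generic point is not a
rational function of `t`. -/
theorem notMem_adjoin_simple_of_disc_ne_zero {K : Type*} [Field K] [Algebra k K] {s t : K}
    {y : Fin (N + 2) → K} (E : IntermediateField k K) (hy : ∀ j, y j ∈ E)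
    (ht : Transcendental E t) (hC : aeval y (linForm D.c) ≠ 0) (hdisc : aeval y D.disc ≠ 0)
    (hF : s ^ 2 * aeval y (linForm D.c) + s * t * aeval y (linForm D.b) +
      t ^ 2 * aeval y (linForm D.a) + s * aeval y D.q₁ + t * aeval y D.q₀ + aeval y D.g = 0) :
    s ∉ IntermediateField.adjoin E {t} := by
  intro h1
  have hm := aeval_mem_of_forall_mem hy
  have h2 := discriminant_eq_zero_of_mem_adjoin (k := E) ht h1
    (a := ⟨_, hm (linForm D.a)⟩) (b := ⟨_, hm (linForm D.b)⟩) (c := ⟨_, hm (linForm D.c)⟩)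
    (q₀ := ⟨_, hm D.q₀⟩) (q₁ := ⟨_, hm D.q₁⟩) (g := ⟨_, hm D.g⟩)
    (fun h ↦ hC (congrArg Subtype.val h)) (by
      simp only [IntermediateField.algebraMap_apply]
      linear_combination hF)
  refine hdisc ?_
  rw [aeval_disc]
  exact congrArg Subtype.val h2

open IntermediateField in
/-- A generic point of the cubic, in terms of the parameters `z`: the plane through the line and `y`
meets the residual conic in the point `(u : 1)` of the line, with `u = z₀`, and in the further point
`(s : t : y)` of the line `s = u t + m`, with `m = z₁`. -/
theorem exists_generic_point (hD : IsNonsingular D.poly) (hc : D.c = Pi.single 0 1) {K : Type u}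
    [Field K] [Algebra k K] {z : Fin (N + 2) → K} (hz : AlgebraicIndependent k z)
    (hgen : adjoin k (Set.range z) = ⊤) :
    ∃ (y : Fin (N + 2) → K) (s t : K), aeval y (linForm D.c) ≠ 0 ∧ y 1 = 1 ∧
      (∀ j : Fin N, y j.succ.succ = z j.succ.succ) ∧ s = z 0 * t + z 1 ∧
      aeval y (linForm D.c) * z 0 ^ 2 + aeval y (linForm D.b) * z 0 + aeval y (linForm D.a) = 0 ∧
      s ^ 2 * aeval y (linForm D.c) + s * t * aeval y (linForm D.b) +
        t ^ 2 * aeval y (linForm D.a) + s * aeval y D.q₁ + t * aeval y D.q₀ + aeval y D.g = 0 ∧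
      AlgebraicIndependent k (frame z (y 0) t) ∧
      z 0 ∉ adjoin k (Set.range (frame z (y 0) t)) ∧
      s ∉ (adjoin k (Set.range (frame z (y 0) t)))⟮z 0⟯ := by
  obtain ⟨y, hy0, hy1, hyz, hymem, hres⟩ := D.exists_residual hD hc hz
  have hC : aeval y (linForm D.c) = y 0 := by rw [hc, linForm_single, aeval_X]
  -- membership of the coordinates of `y` in fields containing the relevant ones
  have hyE : ∀ E : IntermediateField k K, y 0 ∈ E → (∀ j : Fin N, z j.succ.succ ∈ E) →
      ∀ j, y j ∈ E := fun E h0 h j ↦ by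
    refine Fin.cases h0 (Fin.cases ?_ fun j ↦ ?_) j
    · rw [Fin.succ_zero_eq_one, hy1]
      exact one_mem E
    · rw [hyz]
      exact h j
  -- `u` is algebraic over each field containing `y`
  have hualg : ∀ E : IntermediateField k K, (∀ j, y j ∈ E) → IsAlgebraic E (z 0) := fun E hE ↦
    have h := aeval_mem_of_forall_mem hE
    isAlgebraic_of_quadratic (isAlgebraic_of_mem (h _)) (isAlgebraic_of_mem (h _))
      (isAlgebraic_of_mem (h _)) (hC ▸ hy0) hres
  have hτ0 : ∀ x x', x ∈ adjoin k (Set.range (frame z x x')) := fun x x' ↦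
    subset_adjoin _ _ ⟨0, rfl⟩
  have hτ1 : ∀ x x', x' ∈ adjoin k (Set.range (frame z x x')) := fun x x' ↦
    subset_adjoin _ _ ⟨1, rfl⟩
  have hτz : ∀ x x' j, z (Fin.succ (Fin.succ j)) ∈ adjoin k (Set.range (frame z x x')) :=
      fun x x' j ↦
    subset_adjoin _ _ ⟨j.succ.succ, rfl⟩
  have hyτ : ∀ x, ∀ j, y j ∈ adjoin k (Set.range (frame z (y 0) x)) := fun x ↦
    hyE _ (hτ0 _ _) (hτz _ _)
  have hyτ' : ∀ x j, j ≠ 1 → y j = frame z (y 0) x j := fun x ↦ by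
    refine Fin.cases (fun _ ↦ rfl) (Fin.cases (fun h ↦ (h rfl).elim) fun j _ ↦ hyz j)
  have hind₁ : AlgebraicIndependent k (frame z (y 0) (z 1)) := by
    refine algebraicIndependent_of_isAlgebraic hz hgen _ fun i ↦ ?_
    refine Fin.cases (hualg _ (hyτ _)) (Fin.cases (isAlgebraic_of_mem (hτ1 _ _)) fun j ↦
      isAlgebraic_of_mem (hτz _ _ j)) i
  -- a form which vanishes at `y` vanishes identically
  have hdep : ∀ (d : ℕ) (p : MvPolynomial (Fin (N + 2)) k), p.IsHomogeneous d → aeval y p = 0 →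
      p = 0 := fun d p hp h ↦ by
    refine CubicUnirational.IsHomogeneous.eq_zero_of_aeval_eq_zero hp 1 y hy1 ?_ h
    convert hind₁.comp (Subtype.val : {j // j ≠ (1 : Fin (N + 2))} → _)
      Subtype.val_injective using 2
      with j
    exact hyτ' _ j.1 j.2
  have hdepl : ∀ l : Fin (N + 2) → k, aeval y (linForm l) = 0 → l = 0 := fun l hl ↦
    by_contra fun h ↦ linForm_ne_zero h (hdep 1 _ (linForm_isHomogeneous l) hl)
  have hdisc : aeval y D.disc ≠ 0 := fun h ↦ D.disc_ne_zero hD hc (hdep 5 _ D.disc_isHomogeneous h)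
  have hyz' : ∀ j, y j ∈ adjoin k (z '' {1}ᶜ) := hyE _ hymem fun j ↦
    subset_adjoin _ _ ⟨j.succ.succ, by
      rw [Set.mem_compl_singleton_iff, ← Fin.succ_zero_eq_one]
      exact fun h ↦ Fin.succ_ne_zero j (Fin.succ_injective _ h), rfl⟩
  have hden := D.residual_denominator_ne_zero (m := z 1) (adjoin k (z '' {1}ᶜ))
    (subset_adjoin _ _ ⟨0, by simp, rfl⟩) hyz' (transcendental_adjoin_image_compl hz 1) hdisc hres
  -- the second point in which the line through `(u : 1 : 0)` and `(m : 0 : y)` meets the conic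
  obtain ⟨t, ht⟩ : ∃ t, t * (z 1 * (aeval y (linForm D.b) + 2 * z 0 * aeval y (linForm D.c)) +
      (aeval y D.q₀ + z 0 * aeval y D.q₁)) =
      -(aeval y (linForm D.c) * z 1 ^ 2 + aeval y D.q₁ * z 1 + aeval y D.g) :=
    ⟨_, div_mul_cancel₀ _ hden⟩
  obtain ⟨s, hs⟩ : ∃ s, s = z 0 * t + z 1 := ⟨_, rfl⟩
  have hF : s ^ 2 * aeval y (linForm D.c) + s * t * aeval y (linForm D.b) +
      t ^ 2 * aeval y (linForm D.a) + s * aeval y D.q₁ + t * aeval y D.q₀ + aeval y D.g = 0 := by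
    rw [hs]
    linear_combination t ^ 2 * hres + ht
  have hmalg : ∀ E : IntermediateField k K, (∀ j, y j ∈ E) → t ∈ E → IsAlgebraic E (z 1) :=
    fun E hE htE ↦ by
      have h := fun p ↦ isAlgebraic_of_mem (aeval_mem_of_forall_mem hE p)
      have ht' := isAlgebraic_of_mem htE
      have hu := hualg E hE
      have h2 : IsAlgebraic E (2 : K) := isAlgebraic_of_mem (ofNat_mem E 2)
      refine isAlgebraic_of_quadratic (c := aeval y (linForm D.c))
        (b := aeval y D.q₁ + t * (aeval y (linForm D.b) + 2 * z 0 * aeval y (linForm D.c)))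
        (a := aeval y D.g + t * (aeval y D.q₀ + z 0 * aeval y D.q₁)) ?_ ?_ (h _) (hC ▸ hy0) ?_
      · exact (h _).add (ht'.mul ((h _).add (hu.mul (h _))))
      · exact (h _).add (ht'.mul ((h _).add ((h2.mul hu).mul (h _))))
      · linear_combination ht
  have hind : AlgebraicIndependent k (frame z (y 0) t) := by
    refine algebraicIndependent_of_isAlgebraic hz hgen _ fun i ↦ ?_
    exact Fin.cases (hualg _ (hyτ _)) (Fin.cases (hmalg _ (hyτ _) (hτ1 _ _)) fun j ↦
      isAlgebraic_of_mem (hτz _ _ j)) i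
  have hcompl : ∀ x, ∀ j, y j ∈ adjoin k (frame z (z 0) x '' {1}ᶜ) := fun x j ↦ by
    refine adjoin.mono k _ _ ?_ (hyz' j)
    rintro _ ⟨i, hi, rfl⟩
    refine ⟨i, hi, ?_⟩
    revert hi
    exact Fin.cases (fun _ ↦ rfl) (Fin.cases (fun h ↦ (h rfl).elim) fun j _ ↦ rfl) i
  have hind' : AlgebraicIndependent k (frame z (z 0) t) := by
    refine algebraicIndependent_of_isAlgebraic hz hgen _ fun i ↦ ?_
    exact Fin.cases (isAlgebraic_of_mem (hτ0 _ _)) (Fin.cases (hmalg _ (fun j ↦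
      adjoin.mono k _ _ (Set.image_subset_range _ _) (hcompl t j)) (hτ1 _ _)) fun j ↦
      isAlgebraic_of_mem (hτz _ _ j)) i
  have hC0 : aeval y (linForm D.c) ≠ 0 := hC ▸ hy0
  refine ⟨y, s, t, hC0, hy1, hyz, hs, hres, hF, hind,
    D.notMem_adjoin_of_residual hD hc hind hy1 (hyτ' t) hdepl hres, fun h ↦ ?_⟩
  refine D.notMem_adjoin_simple_of_disc_ne_zero (adjoin k (frame z (z 0) t '' {1}ᶜ)) (hcompl t)
    (transcendental_adjoin_image_compl hind' 1) hC0 hdisc hF ?_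
  have hu : z 0 ∈ adjoin k (frame z (z 0) t '' {1}ᶜ) := subset_adjoin _ _ ⟨0, by simp, rfl⟩
  refine adjoin_simple_le rfl ?_ (mem_adjoin_simple_of_mem _ hu) h
  rintro _ ⟨i, rfl⟩
  refine Fin.cases (mem_adjoin_simple_of_mem _ (hcompl t 0)) (Fin.cases
    (mem_adjoin_simple_self _ _) fun j ↦ mem_adjoin_simple_of_mem _ ?_) i
  have := hcompl t j.succ.succ
  rwa [hyz] at this

open IntermediateField in
/-- A smooth cubic with a rational line is parametrized twice by the generic point. -/
theorem hasDoubleParam_poly (hD : IsNonsingular D.poly) (hc : D.c = Pi.single 0 1) {K : Type u}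
    [Field K] [Algebra k K] {z : Fin (N + 2) → K} (hz : AlgebraicIndependent k z)
    (hgen : adjoin k (Set.range z) = ⊤) : HasDoubleParam D.poly K := by
  obtain ⟨y, s, t, hCL, hy1, hyz, hs, hres, hF, hind, huL, hsL⟩ :=
    D.exists_generic_point hD hc hz hgen
  have hyτ : ∀ j, y j ∈ adjoin k (Set.range (frame z (y 0) t)) :=
    Fin.cases (subset_adjoin _ _ ⟨0, rfl⟩) (Fin.cases (by
      rw [Fin.succ_zero_eq_one, hy1]; exact one_mem _) fun j ↦ by
        rw [hyz]; exact subset_adjoin _ _ ⟨j.succ.succ, rfl⟩)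
  generalize hL : adjoin k (Set.range (frame z (y 0) t)) = L at hyτ huL hsL
  have hyL : ∀ p, aeval y p ∈ L := aeval_mem_of_forall_mem hyτ
  have htL : t ∈ L := hL ▸ subset_adjoin _ _ ⟨1, rfl⟩
  have hv1 : (Fin.cons s (Fin.cons t y) : Fin (N + 4) → K) 3 = 1 := hy1
  have hpoly : aeval (Fin.cons s (Fin.cons t y) : Fin (N + 4) → K) D.poly = 0 := by
    rw [aeval_poly]
    linear_combination hF
  refine ⟨Fin.cons s (Fin.cons t y), fun h ↦ one_ne_zero (hv1.symm.trans (congrFun h 3)), hpoly,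
    fun d G hG h0 ↦ ?_, ?_⟩
  · refine D.poly_dvd_of_aeval_eq_zero hD hc L (fun h ↦ hsL (mem_adjoin_simple_of_mem _ h))
      (w := Fin.cons t y) (Fin.cases htL (hyτ)) (fun d p hp h ↦ ?_) hpoly hG h0
    refine CubicUnirational.IsHomogeneous.eq_zero_of_aeval_eq_zero hp 2 _ hy1 ?_ h
    convert hind.comp _ cons_injective_ne_two using 2 with j
    obtain ⟨j, hj⟩ := j
    revert hj
    refine Fin.cases (fun _ ↦ rfl) (Fin.cases (fun _ ↦ rfl) (Fin.cases (fun h ↦ (h rfl).elim)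
      fun j _ ↦ hyz j)) j
  · have hE : adjoin k {x | ∃ i j, x = (Fin.cons s (Fin.cons t y) : Fin (N + 4) → K) i /
        (Fin.cons s (Fin.cons t y) : Fin (N + 4) → K) j} = restrictScalars k L⟮s⟯ := by
      have hLs : ∀ x ∈ L, x ∈ L⟮s⟯ := fun x hx ↦ mem_adjoin_simple_of_mem _ hx
      apply le_antisymm
      · rw [adjoin_le_iff]
        rintro _ ⟨i, j, rfl⟩
        have hv : ∀ i, (Fin.cons s (Fin.cons t y) : Fin (N + 4) → K) i ∈ L⟮s⟯ :=
          Fin.cases (mem_adjoin_simple_self _ _) (Fin.cases (hLs _ htL) fun j ↦ hLs _ (hyτ j))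
        exact div_mem (hv i) (hv j)
      · have hv : ∀ i, (Fin.cons s (Fin.cons t y) : Fin (N + 4) → K) i ∈ adjoin k {x | ∃ i j, x =
          (Fin.cons s (Fin.cons t y) : Fin (N + 4) → K) i /
            (Fin.cons s (Fin.cons t y) : Fin (N + 4) → K) j} := fun i ↦
          subset_adjoin _ _ ⟨i, 3, by rw [hv1, div_one]⟩
        rw [restrictScalars_adjoin, adjoin_le_iff, Set.union_subset_iff]
        constructor
        · change L ≤ _
          rw [← hL, adjoin_le_iff]
          rintro _ ⟨i, rfl⟩
          refine Fin.cases (hv 2) (Fin.cases (hv 1) fun j ↦ ?_) i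
          have := hv j.succ.succ.succ.succ
          rwa [Fin.cons_succ, Fin.cons_succ, hyz] at this
        · rintro _ rfl
          exact hv 0
    rw [hE]
    refine finrank_eq_two_of_quadratic (k := L) (u := z 0) (s := s)
      (b := ⟨_, div_mem (hyL (linForm D.b)) (hyL (linForm D.c))⟩)
      (a := ⟨_, div_mem (hyL (linForm D.a)) (hyL (linForm D.c))⟩)
      (d := ⟨_, div_mem (add_mem (mul_mem htL (hyL (linForm D.b))) (hyL D.q₁))
        (hyL (linForm D.c))⟩)
      (c := ⟨_, div_mem (add_mem (add_mem (mul_mem (pow_mem htL 2) (hyL (linForm D.a)))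
        (mul_mem htL (hyL D.q₀))) (hyL D.g)) (hyL (linForm D.c))⟩) ?_ ?_ ?_ hsL L⟮s⟯ rfl ?_
    · simp only [IntermediateField.algebraMap_apply]
      field_simp
      linear_combination hres
    · simp only [IntermediateField.algebraMap_apply]
      field_simp
      linear_combination hF
    · rintro ⟨x, hx⟩
      exact huL (hx ▸ x.2)
    · rw [← restrictScalars_eq_top_iff (K := L), ← restrictScalars_eq_top_iff (K := k), eq_top_iff,
        ← hgen, adjoin_le_iff]
      have hu : z 0 ∈ L⟮s⟯⟮z 0⟯ := mem_adjoin_simple_self _ _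
      have hLs : ∀ x ∈ L⟮s⟯, x ∈ L⟮s⟯⟮z 0⟯ := fun x hx ↦
        IntermediateField.algebraMap_mem L⟮s⟯⟮z 0⟯ ⟨x, hx⟩
      rintro _ ⟨i, rfl⟩
      refine Fin.cases hu (Fin.cases ?_ fun j ↦ hLs _ (mem_adjoin_simple_of_mem _ ?_)) i
      · rw [Fin.succ_zero_eq_one, show z 1 = s - z 0 * t by rw [hs]; ring]
        exact sub_mem (hLs _ (mem_adjoin_simple_self _ _))
          (mul_mem hu (hLs _ (mem_adjoin_simple_of_mem _ htL)))
      · rw [← hyz]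
        exact hyτ _

end LineCubic

open IntermediateField in
/-- A nonsingular cubic form which vanishes on a line has a double parametrization: in suitable
coordinates the line is the line `y = 0`, and the linear form `C` is a coordinate. -/
theorem hasDoubleParam_of_line {k : Type u} [Field k] {n : ℕ} (hn : 2 ≤ n)
    {F : MvPolynomial (Fin (n + 2)) k} (hF : F.IsHomogeneous 3) (hns : IsNonsingular F)
    {l : Fin n → MvPolynomial (Fin (n + 2)) k} (hl : ∀ r, (l r).IsHomogeneous 1)
    (hli : LinearIndependent k l)
    (hFl : ∀ t, ∃ N : ℕ, X t ^ N * F ∈ Ideal.span (Set.range l))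
    {K : Type u} [Field K] [Algebra k K] {z : Fin n → K} (hz : AlgebraicIndependent k z)
    (hgen : adjoin k (Set.range z) = ⊤) : HasDoubleParam F K := by
  obtain ⟨N, rfl⟩ : ∃ N, n = N + 2 := ⟨n - 2, by omega⟩
  choose a ha using fun r ↦ IsHomogeneous.exists_eq_linForm (hl r)
  have hai : LinearIndependent k a := by
    rw [Fintype.linearIndependent_iff] at hli ⊢
    intro g hg
    refine hli g ?_
    have : ∀ r, l r = ∑ j, a r j • (X j : MvPolynomial (Fin (N + 2 + 2)) k) := fun r ↦ by
      rw [ha r, linForm]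
      exact Finset.sum_congr rfl fun j _ ↦ by rw [smul_eq_C_mul]
    simp only [this, Finset.smul_sum, smul_smul]
    rw [Finset.sum_comm]
    refine Finset.sum_eq_zero fun j _ ↦ ?_
    rw [← Finset.sum_smul]
    have := congrFun hg j
    simp only [Finset.sum_apply, Pi.smul_apply, smul_eq_mul, Pi.zero_apply] at this
    rw [this, zero_smul]
  obtain ⟨M, M', hM, hMl⟩ := exists_matrix_of_linearIndependent
    (fun j : Fin (N + 2) ↦ (j.succ.succ : Fin (N + 2 + 2)))
    (fun i j h ↦ Fin.succ_injective _ (Fin.succ_injective _ h)) a hai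
  -- the generic point `p` of the line is `(1 : T : 0)` in the new coordinates
  let q : Fin (N + 2 + 2) → Polynomial k := Fin.cons 1 (Fin.cons Polynomial.X 0)
  let p : Fin (N + 2 + 2) → Polynomial k := fun i ↦ aeval q (linForm (M' i))
  have hp : ∀ G, aeval p G = aeval q (linSubst M' G) := fun G ↦ (aeval_linSubst _ _ _).symm
  have hlin : ∀ i, aeval p (linForm (M i)) = q i := fun i ↦ by
    rw [hp, linSubst_linForm, ← Matrix.mul_apply_eq_vecMul, hM,
      show (1 : Matrix (Fin (N + 2 + 2)) (Fin (N + 2 + 2)) k) i = Pi.single i 1 by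
        ext j; simp [Matrix.one_apply, Pi.single_apply, eq_comm], LineCubic.linForm_single, aeval_X]
  have hlp : ∀ r, aeval p (l r) = 0 := fun r ↦ by
    rw [ha r, ← hMl r, hlin]
    rfl
  have hspan : Ideal.span (Set.range l) ≤ RingHom.ker (aeval (R := k) p) := by
    rw [Ideal.span_le]
    rintro _ ⟨r, rfl⟩
    exact hlp r
  obtain ⟨t, ht⟩ : ∃ t, p t ≠ 0 := by
    by_contra! h
    have := hlin 0
    rw [aeval_linForm] at this
    simp [h, q] at this
  obtain ⟨m, hm⟩ := hFl t
  have hFp : aeval p F = 0 := by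
    have := hspan hm
    rw [RingHom.mem_ker, map_mul, map_pow, aeval_X] at this
    exact (mul_eq_zero.mp this).resolve_left (pow_ne_zero _ ht)
  have hM' := mul_eq_one_comm.mp hM
  refine HasDoubleParam.of_linSubst hM' ?_
  obtain ⟨D, hD⟩ := LineCubic.exists_eq_poly (IsHomogeneous.linSubst hF M') (by rw [← hp, hFp])
  have hDns : IsNonsingular D.poly := hD ▸ IsNonsingular.linSubst hns hM'
  rw [hD]
  obtain ⟨P, P', hP, hc⟩ := D.exists_substY_c_eq (D.c_ne_zero hDns) 0
  have hPe := LineCubic.extendMatrix_mul_eq_one hP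
  refine HasDoubleParam.of_linSubst hPe ?_
  have hns' := IsNonsingular.linSubst hDns hPe
  rw [LineCubic.linSubst_extendMatrix_poly] at hns' ⊢
  exact LineCubic.hasDoubleParam_poly _ hns' hc hz hgen

/-! ### Degree-zero fractions and their values at points -/

section Away

open HomogeneousLocalization

attribute [local instance] MvPolynomial.gradedAlgebra

variable {k : Type u} [Field k] {n : ℕ}

theorem X_mem_homogeneousSubmodule (t : Fin (n + 1)) :
    X t ∈ homogeneousSubmodule (Fin (n + 1)) k 1 :=
  isHomogeneous_X k t

/-- The value at a point `v` with `f(v)` invertible of a fraction of degree zero with denominator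
a power of `f`. -/
noncomputable def evalAway {B : Type*} [CommRing B] [Algebra k B] (v : Fin (n + 1) → B)
    {f : MvPolynomial (Fin (n + 1)) k} (hf : IsUnit (aeval v f)) :
    Away (homogeneousSubmodule (Fin (n + 1)) k) f →+* B :=
  (IsLocalization.Away.lift (S := Localization.Away f) f (g := (aeval v).toRingHom) hf).comp
    (algebraMap _ (Localization.Away f))

theorem evalAway_mk {B : Type*} [CommRing B] [Algebra k B] (v : Fin (n + 1) → B)
    {f : MvPolynomial (Fin (n + 1)) k} (hf : IsUnit (aeval v f)) {d : ℕ}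
    (hd : f ∈ homogeneousSubmodule (Fin (n + 1)) k d) (m : ℕ) (G : MvPolynomial (Fin (n + 1)) k)
    (hG : G ∈ homogeneousSubmodule (Fin (n + 1)) k (m • d)) :
    evalAway v hf (Away.mk _ hd m G hG) * aeval v f ^ m = aeval v G := by
  have h1 : Localization.mk G (⟨f ^ m, m, rfl⟩ : Submonoid.powers f) *
      algebraMap _ (Localization.Away f) (f ^ m) = algebraMap _ (Localization.Away f) G := by
    rw [Localization.mk_eq_mk']
    exact IsLocalization.mk'_spec _ _ _
  have h2 := congrArg (IsLocalization.Away.lift (S := Localization.Away f) f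
    (g := (aeval v).toRingHom) hf) h1
  rw [map_mul, IsLocalization.Away.lift_eq, IsLocalization.Away.lift_eq, map_pow] at h2
  exact h2

theorem evalAway_awayMap {B : Type*} [CommRing B] [Algebra k B] (v : Fin (n + 1) → B)
    {f g x : MvPolynomial (Fin (n + 1)) k} {d e : ℕ}
    (hd : f ∈ homogeneousSubmodule (Fin (n + 1)) k d)
    (he : g ∈ homogeneousSubmodule (Fin (n + 1)) k e) (hx : x = f * g)
    (hf : IsUnit (aeval v f)) (hxu : IsUnit (aeval v x)) :
    (evalAway v hxu).comp (awayMap _ he hx) = evalAway v hf := by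
  ext a
  obtain ⟨m, G, hG, rfl⟩ := Away.mk_surjective _ hd a
  rw [RingHom.comp_apply, awayMap_mk]
  have h1 := evalAway_mk v hxu (hx ▸ SetLike.mul_mem_graded hd he) m (G * g ^ m)
    (by rw [smul_add]; exact SetLike.mul_mem_graded hG (SetLike.pow_mem_graded m he))
  have h2 := evalAway_mk v hf hd m G hG
  refine (hxu.pow m).mul_right_cancel ?_
  rw [h1, map_mul, map_pow, ← h2, hx, map_mul, mul_pow, mul_assoc]

variable (k) in
/-- The structure map of a chart of projective space. -/
noncomputable def baseHom (t : Fin (n + 1)) :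
    k →+* Away (homogeneousSubmodule (Fin (n + 1)) k) (X t) :=
  (fromZeroRingHom _ _).comp (algebraMap k (homogeneousSubmodule (Fin (n + 1)) k 0))

variable (k) in
/-- The coordinate function `xₐ / xₜ` on a chart of projective space. -/
noncomputable def chartCoord (t a : Fin (n + 1)) :
    Away (homogeneousSubmodule (Fin (n + 1)) k) (X t) :=
  Away.mk _ (X_mem_homogeneousSubmodule t) 1 (X a) (X_mem_homogeneousSubmodule a)

theorem val_awayMk_mul (t : Fin (n + 1)) (m : ℕ) (G : MvPolynomial (Fin (n + 1)) k)
    (hG : G ∈ homogeneousSubmodule (Fin (n + 1)) k (m • 1)) :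
    (Away.mk _ (X_mem_homogeneousSubmodule t) m G hG).val *
      algebraMap (MvPolynomial (Fin (n + 1)) k)
        (Localization.Away (X t : MvPolynomial (Fin (n + 1)) k)) (X t) ^ m =
      algebraMap (MvPolynomial (Fin (n + 1)) k)
        (Localization.Away (X t : MvPolynomial (Fin (n + 1)) k)) G := by
  rw [Away.val_mk, Localization.mk_eq_mk', ← map_pow]
  exact IsLocalization.mk'_spec (M := Submonoid.powers (X t)) _ G ⟨X t ^ m, m, rfl⟩

theorem val_baseHom (t : Fin (n + 1)) (x : k) :
    (baseHom k t x).val = algebraMap _ _ (C x : MvPolynomial (Fin (n + 1)) k) := by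
  exact Localization.mk_one_eq_algebraMap (M := Submonoid.powers (X t))
    (C x : MvPolynomial (Fin (n + 1)) k)

theorem evalAway_baseHom {B : Type*} [CommRing B] [Algebra k B] (v : Fin (n + 1) → B)
    {t : Fin (n + 1)} (ht : IsUnit (aeval v (X t : MvPolynomial (Fin (n + 1)) k))) (x : k) :
    evalAway v ht (baseHom k t x) = algebraMap k B x := by
  rw [evalAway, RingHom.comp_apply, show algebraMap _ (Localization.Away _) (baseHom k t x) =
    (baseHom k t x).val from rfl, val_baseHom, IsLocalization.Away.lift_eq]
  exact aeval_C _ _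

/-- A ring homomorphism on degree-zero fractions is the evaluation at the images of the coordinate
functions. -/
theorem map_awayMk {B : Type*} [CommRing B] [Algebra k B] {t : Fin (n + 1)}
    (ρ : Away (homogeneousSubmodule (Fin (n + 1)) k) (X t) →+* B)
    (hρ : ρ.comp (baseHom k t) = algebraMap k B) (m : ℕ) (G : MvPolynomial (Fin (n + 1)) k)
    (hG : G ∈ homogeneousSubmodule (Fin (n + 1)) k (m • 1)) :
    ρ (Away.mk _ (X_mem_homogeneousSubmodule t) m G hG) = aeval (fun a ↦ ρ (chartCoord k t a)) G := by
  have h : eval₂ (baseHom k t) (chartCoord k t) G =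
      Away.mk _ (X_mem_homogeneousSubmodule t) m G hG := by
    ext
    let f := algebraMap (MvPolynomial (Fin (n + 1)) k)
      (Localization.Away (X t : MvPolynomial (Fin (n + 1)) k))
    have hu : IsUnit (f (X t)) := IsLocalization.Away.algebraMap_isUnit _
    let _ : Algebra k (Localization.Away (X t : MvPolynomial (Fin (n + 1)) k)) :=
      (f.comp C).toAlgebra
    have h1 : (eval₂ (baseHom k t) (chartCoord k t) G).val =
        aeval (fun a ↦ (chartCoord k t a).val) G := by
      refine (hom_eval₂ G (baseHom k t) (algebraMap
        (Away (homogeneousSubmodule (Fin (n + 1)) k) (X t))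
        (Localization.Away (X t : MvPolynomial (Fin (n + 1)) k))) _).trans ?_
      rw [aeval_def, show (algebraMap (Away (homogeneousSubmodule (Fin (n + 1)) k) (X t))
        (Localization.Away (X t : MvPolynomial (Fin (n + 1)) k))).comp (baseHom k t) =
          algebraMap k _ from RingHom.ext fun x ↦ val_baseHom t x]
      rfl
    have h2 : ∀ a, f (X t) * (chartCoord k t a).val = f (X a) := fun a ↦ by
      have := val_awayMk_mul (k := k) t 1 (X a) (X_mem_homogeneousSubmodule a)
      rwa [pow_one, mul_comm] at this
    have h3 : aeval (fun a ↦ f (X a)) G = f G := by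
      have : aeval (fun a ↦ f (X a)) = (⟨f, fun _ ↦ rfl⟩ : _ →ₐ[k] _) := by
        ext a
        exact aeval_X _ _
      rw [this]
      rfl
    refine (hu.pow m).mul_left_cancel ?_
    rw [h1, ← aeval_mul_of_isHomogeneous (d := m) (by simpa using hG), funext h2, h3, mul_comm]
    exact (val_awayMk_mul t m G hG).symm
  rw [← h, hom_eval₂, hρ]
  rfl

theorem awayMk_mem_idealAway_iff {I : Ideal (MvPolynomial (Fin (n + 1)) k)} {t : Fin (n + 1)}
    (m : ℕ) (G : MvPolynomial (Fin (n + 1)) k)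
    (hG : G ∈ homogeneousSubmodule (Fin (n + 1)) k (m • 1)) :
    Away.mk _ (X_mem_homogeneousSubmodule t) m G hG ∈ idealAway I t ↔ ∃ N : ℕ, X t ^ N * G ∈ I := by
  rw [idealAway, Ideal.mem_comap]
  change Localization.mk G (⟨X t ^ m, m, rfl⟩ : Submonoid.powers (X t)) ∈ _ ↔ _
  rw [Localization.mk_eq_mk', IsLocalization.mk'_mem_map_algebraMap_iff (Submonoid.powers (X t))]
  exact ⟨fun ⟨_, ⟨N, rfl⟩, h⟩ ↦ ⟨N, h⟩, fun ⟨N, h⟩ ↦ ⟨_, ⟨N, rfl⟩, h⟩⟩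

/-- If only the multiples of `F` vanish at `v`, then the fractions which vanish at `v` are those in
the ideal of the hypersurface `F = 0`. -/
theorem ker_evalAway {K : Type*} [Field K] [Algebra k K] {v : Fin (n + 1) → K}
    {F : MvPolynomial (Fin (n + 1)) k} (hF : aeval v F = 0)
    (hdvd : ∀ (d : ℕ) (G : MvPolynomial (Fin (n + 1)) k), G.IsHomogeneous d → aeval v G = 0 → F ∣ G)
    {t : Fin (n + 1)} (ht : IsUnit (aeval v (X t : MvPolynomial (Fin (n + 1)) k))) :
    RingHom.ker (evalAway v ht) = idealAway (Ideal.span {F}) t := by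
  ext a
  obtain ⟨m, G, hG, rfl⟩ := Away.mk_surjective _ (X_mem_homogeneousSubmodule t) a
  rw [awayMk_mem_idealAway_iff, RingHom.mem_ker]
  have h := evalAway_mk v ht (X_mem_homogeneousSubmodule t) m G hG
  simp only [Ideal.mem_span_singleton]
  constructor
  · intro h0
    exact ⟨0, by simpa using hdvd _ G hG (by rw [← h, h0, zero_mul])⟩
  · rintro ⟨N, H, hN⟩
    have h1 := congrArg (aeval v) hN
    rw [map_mul, map_mul, hF, zero_mul, map_pow, ← h] at h1
    exact ((ht.pow m).mul_left_eq_zero).mp (((ht.pow N).mul_right_eq_zero).mp h1)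

end Away

/-! ### Smooth charts are nonsingular -/

/-- The Taylor expansion of a polynomial to the first order. -/
theorem aeval_add_mul {σ k B : Type*} [Fintype σ] [CommRing k] [CommRing B]
    [Algebra k B] (δ g : σ → B) (c : B) (p : MvPolynomial σ k) :
    ∃ r, aeval (fun a ↦ δ a + c * g a) p =
      aeval δ p + c * (∑ a, g a * aeval δ (pderiv a p)) + c ^ 2 * r := by
  classical
  induction p using MvPolynomial.induction_on with
  | C x => exact ⟨0, by simp⟩
  | add p q hp hq =>
    obtain ⟨r₁, h₁⟩ := hp
    obtain ⟨r₂, h₂⟩ := hq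
    refine ⟨r₁ + r₂, ?_⟩
    simp only [map_add, h₁, h₂, mul_add, Finset.sum_add_distrib]
    ring
  | mul_X p b hp =>
    obtain ⟨r, h⟩ := hp
    refine ⟨r * (δ b + c * g b) + (∑ a, g a * aeval δ (pderiv a p)) * g b, ?_⟩
    have h1 : ∑ a, g a * aeval δ (pderiv a (p * X b)) =
        aeval δ p * g b + (∑ a, g a * aeval δ (pderiv a p)) * δ b := by
      simp only [Derivation.leibniz, pderiv_X, smul_eq_mul, map_add, map_mul, aeval_X, mul_add,
        Finset.sum_add_distrib, Finset.sum_mul]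
      congr 1
      · rw [Finset.sum_eq_single b (fun a _ ha ↦ by simp [ha]) (by simp)]
        simp [mul_comm]
      · exact Finset.sum_congr rfl fun a _ ↦ by ring
    rw [map_mul, h, aeval_X, h1, map_mul, aeval_X]
    ring

section

open HomogeneousLocalization

attribute [local instance] MvPolynomial.gradedAlgebra

variable {k : Type u} [Field k] {n : ℕ}

/-- A section of `k[x] / (f²) → k[x] / (f)` sends `x` to `x + f g`, so that
`f (1 + ∑ gₐ ∂ₐ f)` is divisible by `f²`, and `f` has no singular zero. -/
theorem exists_aeval_pderiv_ne_zero {F : MvPolynomial (Fin (n + 1)) k} (hF0 : F ≠ 0) {d : ℕ}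
    (hF : F.IsHomogeneous d) {t : Fin (n + 1)} {S : Type u} [CommRing S]
    (φ : Away (homogeneousSubmodule (Fin (n + 1)) k) (X t) →+* S) (hφ : Function.Surjective φ)
    (hker : RingHom.ker φ = idealAway (Ideal.span {F}) t)
    (hs : (φ.comp (baseHom k t)).FormallySmooth) {Ω : Type u} [Field Ω] [Algebra k Ω]
    {w : Fin (n + 1) → Ω} (hw : w t = 1) (hFw : aeval w F = 0) :
    ∃ a, aeval w (pderiv a F) ≠ 0 := by
  by_contra! hsing
  let P := MvPolynomial {a // a ≠ t} k
  let δ : Fin (n + 1) → P := fun a ↦ if h : a = t then 1 else X ⟨a, h⟩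
  have hδt : δ t = 1 := dif_pos rfl
  let f : P := aeval δ F
  have hf0 : f ≠ 0 := fun h ↦ by
    refine hF0 (CubicUnirational.IsHomogeneous.eq_zero_of_aeval_eq_zero hF t δ hδt ?_ h)
    convert algebraicIndependent_X {a // a ≠ t} k with a
    exact dif_neg a.2
  have hmk : ∀ (I : Ideal P) (y : Fin (n + 1) → P) (G : MvPolynomial (Fin (n + 1)) k),
      aeval (fun a ↦ Ideal.Quotient.mk I (y a)) G = Ideal.Quotient.mk I (aeval y G) := fun I y G ↦ by
    change aeval (fun a ↦ Ideal.Quotient.mkₐ k I (y a)) G = Ideal.Quotient.mkₐ k I (aeval y G)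
    rw [← AlgHom.comp_apply, comp_aeval]
  let I₁ : Ideal P := Ideal.span {f}
  let I₂ : Ideal P := Ideal.span {f ^ 2}
  have hI : I₂ ≤ I₁ := by
    rw [Ideal.span_singleton_le_iff_mem, Ideal.mem_span_singleton]
    exact dvd_pow_self f two_ne_zero
  have hone : aeval (fun a ↦ Ideal.Quotient.mk I₁ (δ a)) (X t : MvPolynomial (Fin (n + 1)) k) =
      1 := by rw [aeval_X, hδt, map_one]
  have hu : IsUnit (aeval (fun a ↦ Ideal.Quotient.mk I₁ (δ a))
      (X t : MvPolynomial (Fin (n + 1)) k)) := hone ▸ isUnit_one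
  let e₀ := evalAway (fun a ↦ Ideal.Quotient.mk I₁ (δ a)) hu
  have he₀ : ∀ m G hG, e₀ (Away.mk _ (X_mem_homogeneousSubmodule t) m G hG) =
      Ideal.Quotient.mk I₁ (aeval δ G) := fun m G hG ↦ by
    have := evalAway_mk _ hu (X_mem_homogeneousSubmodule t) m G hG
    rwa [hone, one_pow, mul_one, hmk] at this
  have hle : RingHom.ker φ ≤ RingHom.ker e₀ := fun a ha ↦ by
    obtain ⟨m, G, hG, rfl⟩ := Away.mk_surjective _ (X_mem_homogeneousSubmodule t) a
    rw [hker, awayMk_mem_idealAway_iff] at ha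
    obtain ⟨N, hN⟩ := ha
    obtain ⟨H, hH⟩ := Ideal.mem_span_singleton.mp hN
    rw [RingHom.mem_ker, he₀, Ideal.Quotient.eq_zero_iff_mem, Ideal.mem_span_singleton]
    refine ⟨aeval δ H, ?_⟩
    simpa [hδt] using congrArg (aeval δ) hH
  algebraize [φ.comp (baseHom k t)]
  have hs₀ : ∀ x, φ.liftOfSurjective hφ ⟨e₀, hle⟩ (φ x) = e₀ x := fun x ↦
    RingHom.liftOfRightInverse_comp_apply _ _ _ ⟨e₀, hle⟩ x
  let s₀ : S →ₐ[k] P ⧸ I₁ :=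
    { φ.liftOfSurjective hφ ⟨e₀, hle⟩ with
      commutes' := fun x ↦ (hs₀ _).trans (evalAway_baseHom _ hu x) }
  let q : P ⧸ I₂ →ₐ[k] P ⧸ I₁ := Ideal.Quotient.factorₐ k hI
  have hq : Function.Surjective q := Ideal.Quotient.factor_surjective hI
  have hqker : IsNilpotent (RingHom.ker (q : P ⧸ I₂ →+* P ⧸ I₁)) := by
    refine ⟨2, ?_⟩
    have : RingHom.ker (q : P ⧸ I₂ →+* P ⧸ I₁) ≤ Ideal.span {Ideal.Quotient.mk I₂ f} := fun x hx ↦ by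
      obtain ⟨x, rfl⟩ := Ideal.Quotient.mk_surjective x
      have : Ideal.Quotient.mk I₁ x = 0 := hx
      rw [Ideal.Quotient.eq_zero_iff_mem, Ideal.mem_span_singleton] at this
      rw [Ideal.mem_span_singleton]
      exact map_dvd _ this
    refine le_bot_iff.mp ((Ideal.pow_right_mono this 2).trans ?_)
    rw [Ideal.span_singleton_pow, ← map_pow, Ideal.Quotient.eq_zero_iff_mem.mpr
      (Ideal.mem_span_singleton_self _), Ideal.span_singleton_eq_bot.mpr rfl]
  let σ : S →ₐ[k] P ⧸ I₂ := Algebra.FormallySmooth.liftOfSurjective s₀ q hq hqker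
  have hσ : ∀ x, q (σ x) = s₀ x := Algebra.FormallySmooth.liftOfSurjective_apply s₀ q hq hqker
  let ρ := (σ : S →+* P ⧸ I₂).comp φ
  have hρ : ρ.comp (baseHom k t) = algebraMap k _ := RingHom.ext fun x ↦ σ.commutes x
  choose y hy using fun a ↦ Ideal.Quotient.mk_surjective (ρ (chartCoord k t a))
  have hyδ : ∀ a, f ∣ y a - δ a := fun a ↦ by
    rw [← Ideal.mem_span_singleton, ← Ideal.Quotient.eq]
    have h1 : q (ρ (chartCoord k t a)) = e₀ (chartCoord k t a) := (hσ _).trans (hs₀ _)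
    rw [← hy a, chartCoord, he₀, aeval_X] at h1
    exact h1
  choose g hg using hyδ
  have hyF : f ^ 2 ∣ aeval y F := by
    rw [← Ideal.mem_span_singleton, ← Ideal.Quotient.eq_zero_iff_mem, ← hmk, funext hy]
    have hFd : F ∈ homogeneousSubmodule (Fin (n + 1)) k (d • 1) := by simpa using hF
    rw [← map_awayMk ρ hρ d F hFd]
    have : Away.mk _ (X_mem_homogeneousSubmodule t) d F hFd ∈ RingHom.ker φ := by
      rw [hker, awayMk_mem_idealAway_iff]
      exact ⟨0, by simp⟩
    rw [RingHom.comp_apply, RingHom.mem_ker.mp this, map_zero]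
  rw [show y = fun a ↦ δ a + f * g a from funext fun a ↦ by rw [← hg a]; ring] at hyF
  obtain ⟨r, hr⟩ := aeval_add_mul δ g f F
  rw [hr] at hyF
  obtain ⟨r', hr'⟩ := hyF
  have h1 : 1 + ∑ a, g a * aeval δ (pderiv a F) = f * (r' - r) := by
    refine mul_left_cancel₀ hf0 ?_
    change f + f * _ + _ = _ at hr'
    linear_combination hr'
  let ev : P →ₐ[k] Ω := aeval fun a : {a // a ≠ t} ↦ w a
  have hev : ∀ G, ev (aeval δ G) = aeval w G := fun G ↦ by
    rw [← AlgHom.comp_apply, comp_aeval]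
    congr 2
    funext a
    by_cases h : a = t
    · subst h
      exact (congrArg ev hδt).trans ((map_one ev).trans hw.symm)
    · exact (congrArg ev (dif_neg h)).trans (aeval_X _ _)
  have h2 := congrArg ev h1
  simp only [map_add, map_one, map_sum, map_mul, hev, hsing, mul_zero, Finset.sum_const_zero,
    add_zero, show ev f = 0 from (hev F).trans hFw, zero_mul] at h2
  exact one_ne_zero h2

theorem isNonsingular_of_formallySmooth {F : MvPolynomial (Fin (n + 1)) k} (hF0 : F ≠ 0) {d : ℕ}
    (hF : F.IsHomogeneous d) {S : Fin (n + 1) → Type u} [∀ t, CommRing (S t)]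
    (φ : ∀ t, Away (homogeneousSubmodule (Fin (n + 1)) k) (X t) →+* S t)
    (hφ : ∀ t, Function.Surjective (φ t))
    (hker : ∀ t, RingHom.ker (φ t) = idealAway (Ideal.span {F}) t)
    (hs : ∀ t, ((φ t).comp (baseHom k t)).FormallySmooth) : IsNonsingular F := by
  intro Ω _ _ w hFw hd
  by_contra hw
  obtain ⟨t, ht⟩ := Function.ne_iff.mp hw
  obtain ⟨a, ha⟩ := exists_aeval_pderiv_ne_zero hF0 hF (φ t) (hφ t) (hker t) (hs t)
    (w := fun a ↦ (w t)⁻¹ * w a) (inv_mul_cancel₀ ht)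
    (by rw [aeval_mul_of_isHomogeneous hF, hFw, mul_zero])
  exact ha (by rw [aeval_mul_of_isHomogeneous hF.pderiv, hd a, mul_zero])

end

/-! ### Integral schemes and function fields from a generic point -/

section

variable {X : Scheme.{u}} {ι : Type*} {U : ι → X.Opens}

theorem isReduced_of_iSup_eq_top (hU : ∀ t, IsAffineOpen (U t)) (hcov : ⨆ t, U t = ⊤)
    (hred : ∀ t, _root_.IsReduced Γ(X, U t)) : IsReduced X := by
  have (x : X) : _root_.IsReduced (X.presheaf.stalk x) := by
    obtain ⟨t, ht⟩ := TopologicalSpace.Opens.mem_iSup.mp (hcov ▸ TopologicalSpace.Opens.mem_top x)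
    obtain ⟨p, rfl⟩ : x ∈ Set.range (hU t).fromSpec := (hU t).range_fromSpec ▸ ht
    exact isReduced_of_injective _
      (asIso <| (hU t).fromSpec.stalkMap p).commRingCatIsoToRingEquiv.injective
  exact isReduced_of_isReduced_stalk _

variable {K : Type u} [Field K] {γ : Spec (.of K) ⟶ X}

/-- A `K`-valued point of a scheme is generic if the functions on each member of an affine covering
embed into `K` by evaluation. -/
theorem isGenericPoint_of_injective (hU : ∀ t, IsAffineOpen (U t)) (hcov : ⨆ t, U t = ⊤)
    (ψ : ∀ t, Γ(X, U t) ⟶ .of K) (hψ : ∀ t, Function.Injective (ψ t).hom)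
    (hγ : ∀ t, γ = Spec.map (ψ t) ≫ (hU t).fromSpec) :
    IsGenericPoint (γ (IsLocalRing.closedPoint K)) Set.univ := by
  refine isGenericPoint_def.mpr (Set.eq_univ_of_forall fun x ↦ ?_)
  obtain ⟨t, ht⟩ := TopologicalSpace.Opens.mem_iSup.mp (hcov ▸ TopologicalSpace.Opens.mem_top x)
  obtain ⟨p, rfl⟩ : x ∈ Set.range (hU t).fromSpec := (hU t).range_fromSpec ▸ ht
  rw [← specializes_iff_mem_closure, hγ t]
  change (hU t).fromSpec (Spec.map (ψ t) (IsLocalRing.closedPoint K)) ⤳ _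
  refine Specializes.map ?_ (hU t).fromSpec.continuous
  refine (PrimeSpectrum.le_iff_specializes _ _).mp ?_
  intro a ha
  have h0 : (ψ t).hom a = 0 := by
    have : (ψ t).hom a ∈ IsLocalRing.maximalIdeal K := ha
    rwa [IsLocalRing.maximalIdeal_eq_bot] at this
  rw [(injective_iff_map_eq_zero _).mp (hψ t) a h0]
  exact p.asIdeal.zero_mem

theorem isIntegral_of_injective (hU : ∀ t, IsAffineOpen (U t)) (hcov : ⨆ t, U t = ⊤)
    (ψ : ∀ t, Γ(X, U t) ⟶ .of K) (hψ : ∀ t, Function.Injective (ψ t).hom)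
    (hγ : ∀ t, γ = Spec.map (ψ t) ≫ (hU t).fromSpec) : IsIntegral X := by
  have : IsReduced X := isReduced_of_iSup_eq_top hU hcov fun t ↦ isReduced_of_injective _ (hψ t)
  have hgen := isGenericPoint_of_injective hU hcov ψ hψ hγ
  have : IsIrreducible (Set.univ : Set X) := by
    rw [← hgen.def]
    exact isIrreducible_singleton.closure
  have : IrreducibleSpace X := (irreducibleSpace_def _).mpr this
  exact isIntegral_of_irreducibleSpace_of_isReduced X

end

section

variable {X Y : Scheme.{u}} [IsIntegral Y]

theorem isDominant_of_fromFunctionField (f : Y ⤏ X)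
    (hgen : IsGenericPoint (f.fromFunctionField (IsLocalRing.closedPoint Y.functionField))
      Set.univ) : f.IsDominant := by
  obtain ⟨f, rfl⟩ := f.exists_rep
  refine (Scheme.PartialMap.isDominant_toRationalMap_iff f).mpr ⟨?_⟩
  refine dense_iff_closure_eq.mpr (Set.eq_univ_of_univ_subset ?_)
  rw [← hgen.def]
  refine closure_mono ?_
  rw [Set.singleton_subset_iff]
  exact ⟨_, rfl⟩

variable [IsIntegral X]

theorem germ_functionFieldMap (f : Y ⤏ X) (hf : f.IsDominant) {V : X.Opens} (hV : IsAffineOpen V)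
    [Nonempty V] (ψ : Γ(X, V) ⟶ Y.functionField)
    (hγ : f.fromFunctionField = Spec.map ψ ≫ hV.fromSpec) :
    X.germToFunctionField V ≫ functionFieldMap f hf = ψ := by
  have hη : genericPoint X ∈ V :=
    ((genericPoint_spec X).mem_open_set_iff V.isOpen).mpr (by simpa using ‹Nonempty V›)
  have h1 : Spec.map (functionFieldMap f hf) ≫ X.fromSpecStalk (genericPoint X) =
      f.fromFunctionField := by
    rw [functionFieldMap, Spec.map_comp, Category.assoc,
      Scheme.SpecMap_stalkSpecializes_fromSpecStalk]
    exact Scheme.Spec_stalkClosedPointTo_fromSpecStalk _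
  rw [← hV.fromSpecStalk_eq_fromSpecStalk hη, IsAffineOpen.fromSpecStalk, ← Category.assoc,
    ← Spec.map_comp, hγ, cancel_mono] at h1
  exact Spec.map_injective h1

/-- The degree of a dominant rational map is the degree of `K(Y)` over the field generated by the
pullbacks of the functions on an affine open subset of `X`. -/
theorem degree_eq_finrank (f : Y ⤏ X) (hf : f.IsDominant) {V : X.Opens} (hV : IsAffineOpen V)
    [Nonempty V] (ψ : Γ(X, V) ⟶ Y.functionField)
    (hγ : f.fromFunctionField = Spec.map ψ ≫ hV.fromSpec) (E : Subfield Y.functionField)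
    (hE : E = Subfield.closure (Set.range ψ.hom)) :
    degree f hf = Module.finrank E Y.functionField := by
  have hg := germ_functionFieldMap f hf hV ψ hγ
  let g : X.functionField →+* Y.functionField := (functionFieldMap f hf).hom
  have hgψ : ∀ a, g (X.germToFunctionField V a) = ψ.hom a := fun a ↦ congrArg (fun φ ↦ φ.hom a) hg
  have hfrac := functionField_isFractionRing_of_isAffineOpen X V hV
  have hrange : g.fieldRange = E := by
    rw [hE]
    apply le_antisymm
    · rintro _ ⟨x, rfl⟩
      obtain ⟨a, b, -, rfl⟩ := IsFractionRing.div_surjective (A := Γ(X, V)) x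
      rw [map_div₀]
      exact div_mem (Subfield.subset_closure ⟨a, (hgψ a).symm⟩)
        (Subfield.subset_closure ⟨b, (hgψ b).symm⟩)
    · rw [Subfield.closure_le]
      rintro _ ⟨a, rfl⟩
      exact ⟨_, hgψ a⟩
  subst hrange
  let _ : Algebra X.functionField Y.functionField := g.toAlgebra
  exact Algebra.finrank_eq_of_equiv_equiv g.rangeRestrictFieldEquiv (RingEquiv.refl _) rfl

end

/-! ### Charts of projective space and of its closed subschemes -/

section

open HomogeneousLocalization

theorem fromSpec_basicOpen {A σ : Type*} [CommRing A] [SetLike σ A] [AddSubgroupClass σ A]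
    (𝒜 : ℕ → σ) [GradedRing 𝒜] {f : A} {m : ℕ} (hf : f ∈ 𝒜 m) (hm : 0 < m) :
    (Proj.isAffineOpen_basicOpen 𝒜 f hf hm).fromSpec =
      Spec.map (Proj.awayToSection 𝒜 f) ≫ Proj.awayι 𝒜 f hf hm := by
  have hU := Proj.isAffineOpen_basicOpen 𝒜 f hf hm
  rw [← cancel_epi hU.isoSpec.hom, hU.isoSpec_hom, hU.toSpecΓ_fromSpec,
    ← Proj.basicOpenIsoSpec_inv_ι, ← Category.assoc, ← Category.assoc]
  have : (Proj.basicOpen 𝒜 f).toSpecΓ ≫ Spec.map (Proj.awayToSection 𝒜 f) =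
      (Proj.basicOpenIsoSpec 𝒜 f hf hm).hom := by
    rw [Proj.basicOpenIsoSpec_hom]
    rfl
  rw [this, Iso.hom_inv_id, Category.id_comp]

end

section

open HomogeneousLocalization

attribute [local instance] MvPolynomial.gradedAlgebra

variable {k : Type u} [Field k] {n : ℕ}

theorem isAffineOpen_chart (t : Fin (n + 1)) :
    IsAffineOpen (ProjSpace.chart t : (ProjSpace k n).Opens) :=
  Proj.isAffineOpen_basicOpen _ _ (X_mem_homogeneousSubmodule t) one_pos

theorem iSup_chart : ⨆ t, (ProjSpace.chart t : (ProjSpace k n).Opens) = ⊤ := by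
  refine Proj.iSup_basicOpen_eq_top' (homogeneousSubmodule (Fin (n + 1)) k) _
    (fun t ↦ ⟨1, X_mem_homogeneousSubmodule t⟩) ?_
  refine eq_top_iff.mpr fun p _ ↦ ?_
  have hp : p ∈ Algebra.adjoin k (Set.range X) := adjoin_range_X (R := k) ▸ Algebra.mem_top
  induction hp using Algebra.adjoin_induction with
  | mem x hx => exact Algebra.subset_adjoin hx
  | algebraMap r =>
    exact Subalgebra.algebraMap_mem _ (algebraMap k (homogeneousSubmodule (Fin (n + 1)) k 0) r)
  | add x y _ _ hx hy => exact add_mem (hx trivial) (hy trivial)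
  | mul x y _ _ hx hy => exact mul_mem (hx trivial) (hy trivial)

instance isIso_chartSections (t : Fin (n + 1)) :
    IsIso (ProjSpace.chartSections t : _ ⟶ Γ(ProjSpace k n, _)) :=
  inferInstanceAs (IsIso (Proj.basicOpenIsoAway _ _ (X_mem_homogeneousSubmodule t) one_pos).hom)

/-- The inclusion of a chart of projective space, as the spectrum of the ring of degree-zero
fractions. -/
noncomputable def chartι (k : Type u) [Field k] {n : ℕ} (t : Fin (n + 1)) :
    Spec (.of (Away (homogeneousSubmodule (Fin (n + 1)) k) (X t))) ⟶ ProjSpace k n :=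
  Proj.awayι _ _ (X_mem_homogeneousSubmodule t) one_pos

theorem fromSpec_chart (t : Fin (n + 1)) : (isAffineOpen_chart (k := k) t).fromSpec =
    Spec.map (ProjSpace.chartSections t) ≫ chartι k t :=
  fromSpec_basicOpen _ (X_mem_homogeneousSubmodule t) one_pos

theorem chartι_toBase (t : Fin (n + 1)) :
    chartι k t ≫ ProjSpace.toBase k n = Spec.map (CommRingCat.ofHom (baseHom k t)) := by
  rw [chartι, ProjSpace.toBase]
  erw [Proj.awayι_toSpecZero_assoc]
  rw [← Spec.map_comp]
  rfl

theorem fromSpec_chart_toBase (t : Fin (n + 1)) :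
    (isAffineOpen_chart (k := k) t).fromSpec ≫ ProjSpace.toBase k n =
      Spec.map (CommRingCat.ofHom (baseHom k t) ≫ ProjSpace.chartSections t) := by
  rw [fromSpec_chart, Category.assoc, chartι_toBase, Spec.map_comp]

/-- The `K`-valued point of projective space with homogeneous coordinates `v` can be computed in
each of the charts which contain it. -/
theorem SpecMap_evalAway_chartι {K : Type u} [Field K] [Algebra k K] (v : Fin (n + 1) → K)
    {t t' : Fin (n + 1)} (ht : IsUnit (aeval v (X t : MvPolynomial (Fin (n + 1)) k)))
    (ht' : IsUnit (aeval v (X t' : MvPolynomial (Fin (n + 1)) k))) :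
    Spec.map (CommRingCat.ofHom (evalAway v ht)) ≫ chartι k t =
      Spec.map (CommRingCat.ofHom (evalAway v ht')) ≫ chartι k t' := by
  have h : IsUnit (aeval v (X t * X t' : MvPolynomial (Fin (n + 1)) k)) := by
    rw [map_mul]
    exact ht.mul ht'
  rw [← evalAway_awayMap v (X_mem_homogeneousSubmodule t) (X_mem_homogeneousSubmodule t') rfl ht h,
    ← evalAway_awayMap v (X_mem_homogeneousSubmodule t') (X_mem_homogeneousSubmodule t)
      (mul_comm _ _) ht' h, CommRingCat.ofHom_comp, CommRingCat.ofHom_comp, Spec.map_comp,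
    Spec.map_comp, Category.assoc, Category.assoc]
  congr 1
  exact (Proj.SpecMap_awayMap_awayι _ (X_mem_homogeneousSubmodule t) one_pos
    (X_mem_homogeneousSubmodule t') rfl).trans (Proj.SpecMap_awayMap_awayι _
      (X_mem_homogeneousSubmodule t') one_pos (X_mem_homogeneousSubmodule t) (mul_comm _ _)).symm

variable {Z : Scheme.{u}} (i : Z ⟶ ProjSpace k n)

/-- The restriction of the functions on a chart of projective space to a closed subscheme. -/
noncomputable def chartHom (t : Fin (n + 1)) :
    CommRingCat.of (Away (homogeneousSubmodule (Fin (n + 1)) k) (X t)) ⟶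
      Γ(Z, i ⁻¹ᵁ ProjSpace.chart t) :=
  ProjSpace.chartSections t ≫ i.app (ProjSpace.chart t)

theorem chartHom_comp {Z' : Scheme.{u}} (g : Z' ⟶ Z) (t : Fin (n + 1)) :
    chartHom (g ≫ i) t = chartHom i t ≫ g.app (i ⁻¹ᵁ ProjSpace.chart t) := by
  rw [chartHom, chartHom, Scheme.Hom.comp_app, Category.assoc]
  rfl

variable {i} {I : Ideal (MvPolynomial (Fin (n + 1)) k)}

theorem IsZeroScheme.ker_chartHom (h : IsZeroScheme i I) (t : Fin (n + 1)) :
    RingHom.ker (chartHom i t).hom = idealAway I t := by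
  have hb : Function.Bijective (ProjSpace.chartSections (k := k) t).hom :=
    ConcreteCategory.bijective_of_isIso (ProjSpace.chartSections (k := k) t)
  rw [chartHom, CommRingCat.hom_comp, ← RingHom.comap_ker, h.ker_app,
    Ideal.comap_map_of_bijective _ hb]

theorem IsZeroScheme.chartHom_surjective (h : IsZeroScheme i I) (t : Fin (n + 1)) :
    Function.Surjective (chartHom i t).hom := by
  have := h.isClosedImmersion
  have hb : Function.Bijective (ProjSpace.chartSections (k := k) t).hom :=
    ConcreteCategory.bijective_of_isIso (ProjSpace.chartSections (k := k) t)
  exact (i.app_surjective _ (isAffineOpen_chart t)).comp hb.2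

theorem IsZeroScheme.isAffineOpen_preimage_chart (h : IsZeroScheme i I) (t : Fin (n + 1)) :
    IsAffineOpen (i ⁻¹ᵁ ProjSpace.chart t) := by
  have := h.isClosedImmersion
  exact (isAffineOpen_chart t).preimage i

theorem IsZeroScheme.fromSpec_comp (h : IsZeroScheme i I) (t : Fin (n + 1)) :
    (h.isAffineOpen_preimage_chart t).fromSpec ≫ i = Spec.map (chartHom i t) ≫ chartι k t := by
  have := IsAffineOpen.SpecMap_appLE_fromSpec i (isAffineOpen_chart t)
    (h.isAffineOpen_preimage_chart t) le_rfl
  rw [← this, fromSpec_chart, chartHom, ← Scheme.Hom.app_eq_appLE, Spec.map_comp, Category.assoc]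

theorem IsZeroScheme.formallySmooth (h : IsZeroScheme i I)
    (hs : Smooth (i ≫ ProjSpace.toBase k n)) (t : Fin (n + 1)) :
    ((chartHom i t).hom.comp (baseHom k t)).FormallySmooth := by
  have haff := h.isAffineOpen_preimage_chart t
  have hsm := hs.smooth_appLE (isAffineOpen_top _) haff (le_top (α := Z.Opens))
  have h1 := IsAffineOpen.SpecMap_appLE_fromSpec (i ≫ ProjSpace.toBase k n) (isAffineOpen_top _)
    haff (le_top (α := Z.Opens))
  rw [IsAffineOpen.fromSpec_top, Scheme.isoSpec_Spec_inv, ← Spec.map_comp, ← Category.assoc,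
    h.fromSpec_comp, Category.assoc, chartι_toBase, ← Spec.map_comp] at h1
  have h2 := congrArg CommRingCat.Hom.hom (Spec.map_injective h1)
  rw [CommRingCat.hom_comp, CommRingCat.hom_comp, CommRingCat.hom_ofHom] at h2
  rw [← h2]
  refine RingHom.FormallySmooth.comp (.of_bijective
    (ConcreteCategory.bijective_of_isIso (Scheme.ΓSpecIso (CommRingCat.of k)).inv)) ?_
  algebraize [((i ≫ ProjSpace.toBase k n).appLE ⊤ (i ⁻¹ᵁ ProjSpace.chart t) le_top).hom]
  exact Algebra.Smooth.formallySmooth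

end

/-! ### The function field of projective space -/

section

open HomogeneousLocalization

attribute [local instance] MvPolynomial.gradedAlgebra

variable {k : Type u} [Field k] {n : ℕ}

variable (k n) in
/-- The homogeneous coordinates of the generic point of projective space. -/
noncomputable def genericCoord (a : Fin (n + 1)) : FractionRing (MvPolynomial (Fin (n + 1)) k) :=
  algebraMap (MvPolynomial (Fin (n + 1)) k) _ (X a)

theorem isUnit_aeval_genericCoord (t : Fin (n + 1)) :
    IsUnit (aeval (genericCoord k n) (X t : MvPolynomial (Fin (n + 1)) k)) := by
  rw [aeval_X, isUnit_iff_ne_zero, genericCoord, Ne, FaithfulSMul.algebraMap_eq_zero_iff]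
  exact X_ne_zero t

theorem injective_evalAway_genericCoord (t : Fin (n + 1)) :
    Function.Injective (evalAway _ (isUnit_aeval_genericCoord (k := k) t)) := by
  refine (injective_iff_map_eq_zero _).mpr fun a ha ↦ ?_
  obtain ⟨m, G, hG, rfl⟩ := Away.mk_surjective _ (X_mem_homogeneousSubmodule t) a
  have h := evalAway_mk _ (isUnit_aeval_genericCoord t) (X_mem_homogeneousSubmodule t) m G hG
  have h2 : aeval (genericCoord k n) G = algebraMap _ _ G :=
    (aeval_algebraMap_apply _ X G).trans (by rw [aeval_X_left_apply])
  rw [ha, zero_mul, h2, eq_comm, FaithfulSMul.algebraMap_eq_zero_iff] at h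
  subst h
  ext
  rw [Away.val_mk, Localization.mk_zero, val_zero]

instance nonempty_chart (t : Fin (n + 1)) :
    Nonempty (ProjSpace.chart t : (ProjSpace k n).Opens) := by
  let p : Spec (.of (FractionRing (MvPolynomial (Fin (n + 1)) k))) := IsLocalRing.closedPoint _
  let ψ := inv (ProjSpace.chartSections t) ≫
    CommRingCat.ofHom (evalAway _ (isUnit_aeval_genericCoord (k := k) t))
  have h : (isAffineOpen_chart t).fromSpec (Spec.map ψ p) ∈
      (ProjSpace.chart t : (ProjSpace k n).Opens) := by
    rw [← SetLike.mem_coe, ← (isAffineOpen_chart t).range_fromSpec]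
    exact ⟨_, rfl⟩
  exact ⟨_, h⟩

instance isIntegral_projSpace : IsIntegral (ProjSpace k n) := by
  have ht := isUnit_aeval_genericCoord (k := k) (n := n)
  refine isIntegral_of_injective
    (γ := Spec.map (CommRingCat.ofHom (evalAway _ (ht 0))) ≫ chartι k 0) isAffineOpen_chart
    iSup_chart (fun t ↦ inv (ProjSpace.chartSections t) ≫ CommRingCat.ofHom (evalAway _ (ht t)))
    (fun t ↦ ?_) fun t ↦ ?_
  · rw [CommRingCat.hom_comp]
    exact (injective_evalAway_genericCoord t).comp
      (ConcreteCategory.bijective_of_isIso (inv (ProjSpace.chartSections (k := k) t))).1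
  · rw [SpecMap_evalAway_chartι _ (ht 0) (ht t), fromSpec_chart, ← Category.assoc, ← Spec.map_comp]
    simp

variable {K : Type u} [Field K] [Algebra k K]
  {ρ : Away (homogeneousSubmodule (Fin (n + 1)) k) (X 0) →+* K}

/-- The inverse substitution is the dehomogenization at `x₀ = 1`. -/
theorem algebraicIndependent_chartCoord (hρ : ρ.comp (baseHom k 0) = algebraMap k K)
    (hinj : Function.Injective ρ) :
    AlgebraicIndependent k fun j : Fin n ↦ ρ (chartCoord k 0 j.succ) := by
  let v : Fin (n + 1) → MvPolynomial (Fin n) k := Fin.cons 1 X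
  have hv : aeval v (X 0 : MvPolynomial (Fin (n + 1)) k) = 1 := aeval_X _ _
  have hu : IsUnit (aeval v (X 0 : MvPolynomial (Fin (n + 1)) k)) := hv ▸ isUnit_one
  let σ := eval₂Hom (baseHom k 0) fun j : Fin n ↦ chartCoord k 0 j.succ
  have h1 : (evalAway v hu).comp σ = RingHom.id _ := by
    refine ringHom_ext (fun x ↦ ?_) fun j ↦ ?_
    · rw [RingHom.comp_apply, coe_eval₂Hom, eval₂_C, evalAway_baseHom]
      rfl
    · have := evalAway_mk v hu (X_mem_homogeneousSubmodule 0) 1 (X j.succ)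
        (X_mem_homogeneousSubmodule _)
      rw [hv, one_pow, mul_one, aeval_X] at this
      rw [RingHom.comp_apply, coe_eval₂Hom, eval₂_X]
      exact this
  have h2 (p) : ρ (σ p) = aeval (fun j : Fin n ↦ ρ (chartCoord k 0 j.succ)) p := by
    rw [coe_eval₂Hom, hom_eval₂, hρ, aeval_def]
  refine (algebraicIndependent_iff_injective_aeval).mpr fun p q hpq ↦ ?_
  rw [← h2, ← h2] at hpq
  exact Function.LeftInverse.injective (g := evalAway v hu) (f := σ)
    (fun p ↦ DFunLike.congr_fun h1 p) (hinj hpq)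

theorem adjoin_chartCoord (hρ : ρ.comp (baseHom k 0) = algebraMap k K)
    (hfrac : ∀ x, ∃ a b, x = ρ a / ρ b) :
    IntermediateField.adjoin k (Set.range fun j : Fin n ↦ ρ (chartCoord k 0 j.succ)) = ⊤ := by
  have h (a) : ρ (chartCoord k 0 a) ∈
      IntermediateField.adjoin k (Set.range fun j : Fin n ↦ ρ (chartCoord k 0 j.succ)) := by
    induction a using Fin.cases with
    | zero =>
      have : chartCoord k (0 : Fin (n + 1)) 0 = 1 := by
        ext
        rw [chartCoord, Away.val_mk, val_one]
        simp only [pow_one]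
        exact Localization.mk_self (M := MvPolynomial (Fin (n + 1)) k)
          (S := Submonoid.powers (X 0)) ⟨X 0, 1, pow_one _⟩
      rw [this, map_one]
      exact one_mem _
    | succ j => exact IntermediateField.subset_adjoin _ _ ⟨j, rfl⟩
  have h2 (a) : ρ a ∈
      IntermediateField.adjoin k (Set.range fun j : Fin n ↦ ρ (chartCoord k 0 j.succ)) := by
    obtain ⟨m, G, hG, rfl⟩ := Away.mk_surjective _ (X_mem_homogeneousSubmodule 0) a
    rw [map_awayMk ρ hρ]
    exact aeval_mem_of_forall_mem h G
  refine eq_top_iff.mpr fun x _ ↦ ?_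
  obtain ⟨a, b, rfl⟩ := hfrac x
  exact div_mem (h2 a) (h2 b)

variable (k n) in
/-- The fractions of degree zero with denominator a power of `x₀` as rational functions on
projective space. -/
noncomputable def chartGerm : CommRingCat.of (Away (homogeneousSubmodule (Fin (n + 1)) k) (X 0)) ⟶
    (ProjSpace k n).functionField :=
  ProjSpace.chartSections 0 ≫ (ProjSpace k n).germToFunctionField (ProjSpace.chart 0)

theorem injective_chartGerm : Function.Injective (chartGerm k n).hom := by
  rw [chartGerm, CommRingCat.hom_comp]
  exact (Scheme.germToFunctionField_injective _ _).comp
    (ConcreteCategory.bijective_of_isIso (ProjSpace.chartSections (k := k) 0)).1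

theorem exists_eq_chartGerm_div (x : (ProjSpace k n).functionField) :
    ∃ a b, x = (chartGerm k n).hom a / (chartGerm k n).hom b := by
  have := functionField_isFractionRing_of_isAffineOpen (ProjSpace k n)
    (ProjSpace.chart 0) (isAffineOpen_chart (k := k) 0)
  have hs := (ConcreteCategory.bijective_of_isIso (ProjSpace.chartSections (k := k) (n := n) 0)).2
  obtain ⟨a, b, -, rfl⟩ := IsFractionRing.div_surjective
    (A := Γ(ProjSpace k n, ProjSpace.chart 0)) x
  obtain ⟨a, rfl⟩ := hs a
  obtain ⟨b, rfl⟩ := hs b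
  exact ⟨a, b, rfl⟩

theorem fromSpecStalk_genericPoint_toBase :
    (ProjSpace k n).fromSpecStalk (genericPoint (ProjSpace k n)) ≫ ProjSpace.toBase k n =
      Spec.map (CommRingCat.ofHom ((chartGerm k n).hom.comp (baseHom k 0))) := by
  have hη : genericPoint (ProjSpace k n) ∈ (ProjSpace.chart 0 : (ProjSpace k n).Opens) :=
    ((genericPoint_spec _).mem_open_set_iff (ProjSpace.chart 0).isOpen).mpr
      (by simpa using nonempty_chart (k := k) (n := n) 0)
  rw [← (isAffineOpen_chart 0).fromSpecStalk_eq_fromSpecStalk hη, IsAffineOpen.fromSpecStalk,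
    Category.assoc, fromSpec_chart_toBase, ← Spec.map_comp]
  rfl

end

/-! ### Points of a hypersurface with values in a function field -/

section

open HomogeneousLocalization

attribute [local instance] MvPolynomial.gradedAlgebra

variable {k : Type u} [Field k] {n : ℕ} {F : MvPolynomial (Fin (n + 1)) k} {Z : Scheme.{u}}
  {i : Z ⟶ ProjSpace k n}

/-- A point at which no form vanishes except the multiples of a form of degree at least two has
nonzero coordinates. -/
theorem isUnit_aeval_X {d : ℕ} (hd : 2 ≤ d) (hF0 : F ≠ 0) (hF : F.IsHomogeneous d)
    {K : Type*} [Field K] [Algebra k K] {v : Fin (n + 1) → K}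
    (hdvd : ∀ (e : ℕ) (G : MvPolynomial (Fin (n + 1)) k), G.IsHomogeneous e → aeval v G = 0 → F ∣ G)
    (t : Fin (n + 1)) : IsUnit (aeval v (X t : MvPolynomial (Fin (n + 1)) k)) := by
  rw [isUnit_iff_ne_zero]
  intro h
  have h1 := totalDegree_le_of_dvd_of_isDomain (hdvd 1 _ (isHomogeneous_X k t) h) (X_ne_zero t)
  rw [hF.totalDegree hF0, totalDegree_X] at h1
  omega

theorem evalAway_chartCoord_mul {B : Type*} [CommRing B] [Algebra k B] (v : Fin (n + 1) → B)
    {t : Fin (n + 1)} (ht : IsUnit (aeval v (X t : MvPolynomial (Fin (n + 1)) k)))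
    (a : Fin (n + 1)) : evalAway v ht (chartCoord k t a) * v t = v a := by
  have := evalAway_mk v ht (X_mem_homogeneousSubmodule t) 1 (X a) (X_mem_homogeneousSubmodule a)
  rwa [pow_one, aeval_X, aeval_X] at this

/-- The values at `v` of the functions on a chart of projective space generate the field of
ratios of coordinates. -/
theorem adjoin_ratio_toSubfield {K : Type*} [Field K] [Algebra k K] (v : Fin (n + 1) → K)
    {t : Fin (n + 1)} (ht : IsUnit (aeval v (X t : MvPolynomial (Fin (n + 1)) k))) :
    (IntermediateField.adjoin k {x | ∃ a b, x = v a / v b}).toSubfield =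
      Subfield.closure (Set.range (evalAway v ht)) := by
  have ht0 : v t ≠ 0 := by simpa using ht
  have hc (a) : evalAway v ht (chartCoord k t a) = v a / v t :=
    eq_div_of_mul_eq ht0 (evalAway_chartCoord_mul v ht a)
  apply le_antisymm
  · rw [IntermediateField.adjoin_toSubfield, Subfield.closure_le]
    rintro _ (⟨x, rfl⟩ | ⟨a, b, rfl⟩)
    · exact Subfield.subset_closure ⟨baseHom k t x, evalAway_baseHom v ht x⟩
    · rw [← div_div_div_cancel_right₀ ht0, ← hc, ← hc]
      exact div_mem (Subfield.subset_closure ⟨_, rfl⟩) (Subfield.subset_closure ⟨_, rfl⟩)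
  · rw [Subfield.closure_le]
    rintro _ ⟨x, rfl⟩
    obtain ⟨m, G, hG, rfl⟩ := Away.mk_surjective _ (X_mem_homogeneousSubmodule t) x
    rw [map_awayMk _ (RingHom.ext (evalAway_baseHom v ht))]
    refine aeval_mem_of_forall_mem (fun a ↦ ?_) G
    rw [hc]
    exact IntermediateField.subset_adjoin _ _ ⟨a, t, rfl⟩

/-- The evaluation of functions at a point of a hypersurface at which only the multiples of its
equation vanish. -/
theorem IsZeroScheme.exists_injective_comp_eq (h : IsZeroScheme i (Ideal.span {F}))
    {K : Type u} [Field K] [Algebra k K] {v : Fin (n + 1) → K} (hFv : aeval v F = 0)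
    (hdvd : ∀ (e : ℕ) (G : MvPolynomial (Fin (n + 1)) k), G.IsHomogeneous e → aeval v G = 0 → F ∣ G)
    {t : Fin (n + 1)} (ht : IsUnit (aeval v (X t : MvPolynomial (Fin (n + 1)) k))) :
    ∃ ψ : Γ(Z, i ⁻¹ᵁ ProjSpace.chart t) ⟶ .of K, Function.Injective ψ.hom ∧
      chartHom i t ≫ ψ = CommRingCat.ofHom (evalAway v ht) := by
  have hk : RingHom.ker (chartHom i t).hom = RingHom.ker (evalAway v ht) := by
    rw [h.ker_chartHom, ker_evalAway hFv hdvd]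
  have hs := h.chartHom_surjective t
  let ψ := (chartHom i t).hom.liftOfSurjective hs ⟨evalAway v ht, hk.le⟩
  have hψ (x) : ψ ((chartHom i t).hom x) = evalAway v ht x :=
    RingHom.liftOfRightInverse_comp_apply _ _ (Function.rightInverse_surjInv hs) _ x
  refine ⟨CommRingCat.ofHom ψ, (injective_iff_map_eq_zero ψ).mpr fun y hy ↦ ?_, ?_⟩
  · obtain ⟨x, rfl⟩ := hs y
    rw [hψ] at hy
    exact hk.ge hy
  · ext x
    exact hψ x

/-- A hypersurface with a generic point whose homogeneous coordinates are rational functions on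
projective space is integral and is dominated by this projective space. -/
theorem IsZeroScheme.exists_isUnirationalParameterization {N d e : ℕ}
    {F : MvPolynomial (Fin (N + 1)) k} {i : Z ⟶ ProjSpace k N}
    (h : IsZeroScheme i (Ideal.span {F})) (hfin : LocallyOfFiniteType (i ≫ ProjSpace.toBase k N))
    [Algebra k (ProjSpace k n).functionField]
    (halg : algebraMap k (ProjSpace k n).functionField = (chartGerm k n).hom.comp (baseHom k 0))
    {v : Fin (N + 1) → (ProjSpace k n).functionField} (hFv : aeval v F = 0)
    (hdvd : ∀ (e : ℕ) (G : MvPolynomial (Fin (N + 1)) k), G.IsHomogeneous e → aeval v G = 0 → F ∣ G)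
    (hd : 2 ≤ d) (hF0 : F ≠ 0) (hF : F.IsHomogeneous d) (he : 0 < e)
    (hrank : Module.finrank (IntermediateField.adjoin k {x | ∃ a b, x = v a / v b})
      (ProjSpace k n).functionField = e) :
    ∃ (_ : IsIntegral Z) (f : ProjSpace k n ⤏ Z),
      IsUnirationalParameterization (i ≫ ProjSpace.toBase k N) e f := by
  have := h.isClosedImmersion
  have ht := isUnit_aeval_X hd hF0 hF hdvd
  have haff := h.isAffineOpen_preimage_chart
  choose ψ hinj hψ using fun t ↦ h.exists_injective_comp_eq hFv hdvd (ht t)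
  have hcov : ⨆ t, i ⁻¹ᵁ ProjSpace.chart t = ⊤ := by
    rw [← Scheme.Hom.preimage_iSup, iSup_chart, Scheme.Hom.preimage_top]
  have hγi (t) : (Spec.map (ψ t) ≫ (haff t).fromSpec) ≫ i =
      Spec.map (CommRingCat.ofHom (evalAway v (ht t))) ≫ chartι k t := by
    rw [Category.assoc, h.fromSpec_comp, ← Category.assoc, ← Spec.map_comp, hψ]
  let γ : Spec (ProjSpace k n).functionField ⟶ Z := Spec.map (ψ 0) ≫ (haff 0).fromSpec
  have hγ (t) : γ = Spec.map (ψ t) ≫ (haff t).fromSpec := by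
    rw [← cancel_mono i]
    exact (hγi 0).trans ((SpecMap_evalAway_chartι v (ht 0) (ht t)).trans (hγi t).symm)
  have hZ : IsIntegral Z := isIntegral_of_injective haff hcov ψ hinj hγ
  have hgen := isGenericPoint_of_injective haff hcov ψ hinj hγ
  have hγbase : γ ≫ i ≫ ProjSpace.toBase k N =
      (ProjSpace k n).fromSpecStalk _ ≫ ProjSpace.toBase k n := by
    rw [fromSpecStalk_genericPoint_toBase, ← halg, ← Category.assoc, hγi, Category.assoc,
      chartι_toBase, ← Spec.map_comp, ← CommRingCat.ofHom_comp]
    congr 2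
    exact RingHom.ext (evalAway_baseHom v (ht 0))
  let f := Scheme.RationalMap.ofFunctionField (ProjSpace.toBase k n) (i ≫ ProjSpace.toBase k N) γ
    hγbase
  have hfγ : f.fromFunctionField = γ := Scheme.RationalMap.fromFunctionField_ofFunctionField ..
  have hf : f.IsDominant := isDominant_of_fromFunctionField f (hfγ ▸ hgen)
  have : Nonempty (i ⁻¹ᵁ ProjSpace.chart 0) := by
    refine ⟨γ (IsLocalRing.closedPoint _), ?_⟩
    rw [← SetLike.mem_coe, ← (haff 0).range_fromSpec]
    exact ⟨_, rfl⟩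
  refine ⟨hZ, f, he, (Scheme.RationalMap.equivFunctionField _ _ ⟨γ, hγbase⟩).2, hf, ?_⟩
  rw [← hrank]
  refine degree_eq_finrank f hf (haff 0) (ψ 0) hfγ
    (IntermediateField.adjoin k {x | ∃ a b, x = v a / v b}).toSubfield ?_
  rw [adjoin_ratio_toSubfield v (ht 0)]
  have : (evalAway v (ht 0) : _ → _) = (ψ 0).hom ∘ (chartHom i 0).hom :=
    funext fun x ↦ (congrArg (fun φ ↦ φ.hom x) (hψ 0)).symm
  rw [this, Set.range_comp, (h.chartHom_surjective 0).range_eq, Set.image_univ]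

/-- If the zero scheme of `J` lies in that of `F`, then `F` belongs to `J` up to powers of the
coordinates. -/
theorem IsZeroScheme.exists_pow_mul_mem {L : Scheme.{u}} {J : Ideal (MvPolynomial (Fin (n + 1)) k)}
    (h : IsZeroScheme i (Ideal.span {F})) (g : L ⟶ Z) (hL : IsZeroScheme (g ≫ i) J) {d : ℕ}
    (hF : F.IsHomogeneous d) (t : Fin (n + 1)) : ∃ N : ℕ, X t ^ N * F ∈ J := by
  have hF' : F ∈ homogeneousSubmodule (Fin (n + 1)) k (d • 1) := by simpa using hF
  rw [← awayMk_mem_idealAway_iff d F hF', ← hL.ker_chartHom, RingHom.mem_ker, chartHom_comp]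
  have : Away.mk _ (X_mem_homogeneousSubmodule t) d F hF' ∈ RingHom.ker (chartHom i t).hom := by
    rw [h.ker_chartHom, awayMk_mem_idealAway_iff]
    exact ⟨0, by simp⟩
  exact (congrArg (g.app _).hom (RingHom.mem_ker.mp this)).trans (map_zero _)

/-- A smooth hypersurface is defined by a nonsingular form. -/
theorem IsZeroScheme.isNonsingular (h : IsZeroScheme i (Ideal.span {F}))
    (hs : Smooth (i ≫ ProjSpace.toBase k n)) {d : ℕ} (hF0 : F ≠ 0) (hF : F.IsHomogeneous d) :
    IsNonsingular F :=
  isNonsingular_of_formallySmooth hF0 hF (fun t ↦ (chartHom i t).hom) h.chartHom_surjective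
    h.ker_chartHom (h.formallySmooth hs)

end

end CubicUnirational

theorem mainTheorem5 {k : Type u} [Field k] (n : ℕ) (hn : 2 ≤ n)
    {X : Scheme.{u}} (i : X ⟶ CubicUnirational.ProjSpace k (n + 1))
    (hX : CubicUnirational.IsHypersurface 3 i)
    (hsmooth : Smooth (i ≫ CubicUnirational.ProjSpace.toBase k (n + 1)))
    {L : Scheme.{u}} (j : L ⟶ CubicUnirational.ProjSpace k (n + 1))
    (hL : CubicUnirational.IsLine j) (hLX : ∃ g : L ⟶ X, g ≫ i = j) :
    ∃ (_ : IsIntegral X) (f : CubicUnirational.ProjSpace k n ⤏ X),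
      CubicUnirational.IsUnirationalParameterization
        (i ≫ CubicUnirational.ProjSpace.toBase k (n + 1)) 2 f := by
  obtain ⟨F, hF0, hF, h⟩ := hX
  obtain ⟨l, hl, hli, hlj⟩ := hL
  obtain ⟨g, rfl⟩ := hLX
  let _ : Algebra k (CubicUnirational.ProjSpace k n).functionField :=
    ((CubicUnirational.chartGerm k n).hom.comp (CubicUnirational.baseHom k 0)).toAlgebra
  have hinj := CubicUnirational.injective_chartGerm (k := k) (n := n)
  obtain ⟨v, -, hFv, hdvd, hrank⟩ := CubicUnirational.hasDoubleParam_of_line hn hF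
    (h.isNonsingular hsmooth hF0 hF) hl hli (h.exists_pow_mul_mem g hlj hF)
    (CubicUnirational.algebraicIndependent_chartCoord rfl hinj)
    (CubicUnirational.adjoin_chartCoord rfl CubicUnirational.exists_eq_chartGerm_div)
  exact h.exists_isUnirationalParameterization inferInstance rfl hFv hdvd (by decide) hF0 hF
    two_pos hrank
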